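/- Let $\mathbb K\in\{\mathbb R,\mathbb C\}$ and let $(X,\|\cdot\|,\tau)$ be a bi-admissible space, i.e. $(X,\|\cdot\|)$ is a Banach space over $\mathbb K$ and $\tau$ is a locally convex Hausdorff topology on $X$ which is coarser than the norm topology, for which every $\|\cdot\|$-bounded $\tau$-Cauchy sequence is $\tau$-convergent, and whose dual is norming, i.e. $\|x\|=\sup\{|\varphi(x)|:\varphi\in(X,\tau)',\ \|\varphi\|\le 1\}$ for all $x\in X$. Let $A\colon \mathrm D(A)\subseteq X\to X$ be a linear operator on $X$ such that * $A$ is bi-dissipative: there is a set $\Gamma$ of $\tau$-continuous seminorms on $X$ that is a fundamental system for $\tau$ (every $\tau$-neighbourhood of $0$ contains $\{x: p(x)<\varepsilon\}$ for some $p\in\Gamma$, $\varepsilon>0$), such that $p((\lambda-A)x)\ge\lambda p(x)$ for all $\lambda>0$, $p\in\Gamma$, $x\in\mathrm D(A)$, and $\|x\|=\sup_{p\in\Gamma}p(x)$ for all $x\in X$; * $A$ is bi-densely defined: for each $x\in X$ there is a $\|\cdot\|$-bounded sequence in $\mathrm D(A)$ that $\tau$-converges to $x$; * $A$ is closed, i.e.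 its graph is closed in $X\times X$ for the norm topology. Then the following are equivalent: (a) $A$ generates a bi-continuous contraction semigroup on $X$. (b) There is $\lambda>0$ such that $\lambda-A\colon \mathrm D(A)\to X$ is surjective. Here a bi-continuous semigroup is a family $(T(t))_{t\ge0}$ of bounded linear operators on $X$ with $T(0)=I$, $T(t+s)=T(t)T(s)$ for all $s,t\ge 0$; such that $t\mapsto T(t)x$ is $\tau$-continuous on $[0,\infty)$ for each $x\in X$; such that $\|T(t)\|\le Me^{\omega t}$ for all $t\ge 0$, for some $M\ge1$ and $\omega\in\mathbb R$; and such that for each $\|\cdot\|$-bounded $\tau$-null sequence $(x_n)$ and each $t_0\ge0$ one has $T(s)x_n\to0$ in $\tau$ uniformly for $s\in[0,t_0]$. It is a contraction semigroup if $\|T(t)\|\le1$ for all $t\ge0$. Its generator is the operator $Ax=\tau\text{-}\lim_{t\downarrow0}\frac{T(t)x-x}{t}$ whose domain consists of all $x\in X$ for which this $\tau$-limit exists and $\sup_{t\in(0,1]}\frac{\|T(t)x-x\|}{t}<\infty$. -/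

import Mathlib

open Filter Topology

namespace BiCont

/-- An additional topology on `X`. It is wrapped in a structure so that it is never picked up by
instance resolution: on a normed space `X`, the instance topology is always that of the norm. -/
structure AuxTopology (X : Type*) where
  /-- the underlying topology -/
  top : TopologicalSpace X

variable {𝕜 X : Type*} [RCLike 𝕜] [NormedAddCommGroup X] [NormedSpace 𝕜 X]

/-- A sequence that is bounded in norm. -/
def NormBounded (u : ℕ → X) : Prop :=
  ∃ C : ℝ, ∀ n, ‖u n‖ ≤ C

variable (𝕜) in
/-- `(X, ‖·‖, τ)` is a bi-admissible space (the completeness of the normed space `X` is the separate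
instance `CompleteSpace X`). In Mathlib's order on topologies `t ≤ s` means that `s` is coarser. -/
structure IsBiAdmissible (τ : AuxTopology X) : Prop where
  /-- `τ` is a locally convex vector space topology, i.e. it is induced by seminorms. -/
  locallyConvex : @PolynormableSpace 𝕜 X _ _ _ τ.top
  hausdorff : @T2Space X τ.top
  coarser : (inferInstance : TopologicalSpace X) ≤ τ.top
  /-- Every norm-bounded `τ`-Cauchy sequence is `τ`-convergent. -/
  seqComplete : ∀ u : ℕ → X, NormBounded u →
    Tendsto (fun mn : ℕ × ℕ => u mn.1 - u mn.2) atTop (@nhds X τ.top 0) →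
    ∃ x : X, Tendsto u atTop (@nhds X τ.top x)
  /-- The dual of `(X, τ)` is norming. (A `τ`-continuous functional is norm-continuous, as `τ` is
  coarser than the norm topology, so the `φ` below are all the elements of the dual of `(X, τ)`
  whose dual norm is at most one.) -/
  norming : ∀ x : X,
    IsLUB {r : ℝ | ∃ φ : X →L[𝕜] 𝕜, Continuous[τ.top, inferInstance] φ ∧ ‖φ‖ ≤ 1 ∧ r = ‖φ x‖} ‖x‖

/-- `(T(t))_{t ≥ 0}` is a bi-continuous semigroup with respect to `τ`. -/
structure IsBiContinuousSemigroup (τ : AuxTopology X) (T : NNReal → X →L[𝕜] X) : Prop where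
  map_add : ∀ t s : NNReal, T (t + s) = (T t).comp (T s)
  map_zero : T 0 = ContinuousLinearMap.id 𝕜 X
  stronglyContinuous : ∀ x : X, Continuous[inferInstance, τ.top] (fun t : NNReal => T t x)
  exponentiallyBounded : ∃ M ω : ℝ, 1 ≤ M ∧ ∀ t : NNReal, ‖T t‖ ≤ M * Real.exp (ω * t)
  /-- For norm-bounded `τ`-null sequences `u`, the sequence `T s (u n)` is `τ`-null uniformly for
  `s` in bounded intervals. -/
  locallyBiEquicontinuous : ∀ u : ℕ → X, NormBounded u → Tendsto u atTop (@nhds X τ.top 0) →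
    ∀ t₀ : NNReal, ∀ U ∈ @nhds X τ.top 0, ∀ᶠ n in atTop, ∀ s : NNReal, s ≤ t₀ → T s (u n) ∈ U

/-- The difference quotient `(T(t)x - x) / t` tends to `y` with respect to `τ` as `t ↓ 0`. -/
def HasTauDerivAtZero (τ : AuxTopology X) (T : NNReal → X →L[𝕜] X) (x y : X) : Prop :=
  Tendsto (fun t : NNReal => (((t : ℝ) : 𝕜)⁻¹) • (T t x - x)) (𝓝[>] 0) (@nhds X τ.top y)

/-- `A` is the (infinitesimal) generator of `T`. -/
structure IsGenerator (τ : AuxTopology X) (T : NNReal → X →L[𝕜] X) (A : X →ₗ.[𝕜] X) :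
    Prop where
  mem_domain_iff : ∀ x : X, x ∈ A.domain ↔
    (∃ y : X, HasTauDerivAtZero τ T x y) ∧
      ∃ C : ℝ, ∀ t : NNReal, 0 < t → t ≤ 1 → ‖T t x - x‖ / (t : ℝ) ≤ C
  hasTauDeriv : ∀ x : A.domain, HasTauDerivAtZero τ T (x : X) (A x)

/-- `A` generates a bi-continuous contraction semigroup. -/
def GeneratesContractionSemigroup (τ : AuxTopology X) (A : X →ₗ.[𝕜] X) : Prop :=
  ∃ T : NNReal → X →L[𝕜] X,
    IsBiContinuousSemigroup τ T ∧ (∀ t, ‖T t‖ ≤ 1) ∧ IsGenerator τ T A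

/-- The domain of `A` is bi-dense. -/
def BiDenselyDefined (τ : AuxTopology X) (A : X →ₗ.[𝕜] X) : Prop :=
  ∀ x : X, ∃ u : ℕ → X, (∀ n, u n ∈ A.domain) ∧ NormBounded u ∧ Tendsto u atTop (@nhds X τ.top x)

/-- `Γ` is a fundamental system of seminorms for `τ`: its members are `τ`-continuous, and their
unit balls form, up to scaling, a base of neighbourhoods of zero. -/
structure IsFundamentalSystem (τ : AuxTopology X) (Γ : Set (Seminorm 𝕜 X)) : Prop where
  continuous : ∀ p ∈ Γ, Continuous[τ.top, inferInstance] p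
  exists_ball_subset : ∀ U ∈ @nhds X τ.top 0, ∃ p ∈ Γ, ∃ ε : ℝ, 0 < ε ∧ {x : X | p x < ε} ⊆ U

/-- `A` is bi-dissipative. -/
def BiDissipative (τ : AuxTopology X) (A : X →ₗ.[𝕜] X) : Prop :=
  ∃ Γ : Set (Seminorm 𝕜 X), IsFundamentalSystem τ Γ ∧
    (∀ l : ℝ, 0 < l → ∀ p ∈ Γ, ∀ x : A.domain, l * p (x : X) ≤ p ((l : 𝕜) • (x : X) - A x)) ∧
    ∀ x : X, IsLUB {r : ℝ | ∃ p ∈ Γ, r = p x} ‖x‖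

end BiCont

namespace BiCont

variable {𝕜 X : Type*} [RCLike 𝕜] [NormedAddCommGroup X] [NormedSpace 𝕜 X]

/-! This is the Lumer–Phillips theorem run in all seminorms of `Γ` at once. Convergence for `τ` is
convergence for each `p ∈ Γ` (`tendsto_nhds_iff_seminormTendsto`), and since the norm is the
supremum of `Γ`, estimates uniform over `Γ` become norm estimates and limits are unique.

From range to semigroup: dissipativity makes every `l R(l)` a `p`-contraction, and a Neumann series
spreads surjectivity from one `l` to all positive ones (`IsDissipativeFor.isOntoAt`). The Yosida
approximations `r (r R(r) - 1)` commute and generate `p`-contractive groups, so `p (exp (tB) x - exp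
(tC) x) ≤ t p (B x - C x)` makes these groups Cauchy on the domain, hence everywhere by density.
Bounded completeness provides the limit semigroup. Its generator extends `A`, and no proper
extension is possible because `1 - A` is onto (`mem_domain_of_diffQuotient_tendsto`).

From semigroup to range: a Laplace transform cut off at time 1 suffices. The integral `J` of `exp
(-t) T(t) z` over `[0, 1]` satisfies `(1 - A) J = z - exp (-1) T(1) z` (`exists_sub_generator_eq`),
and `1 - exp (-1) T(1)` is onto by a Neumann series. Orbits are only `τ`-continuous, so `J` is built
from Riemann sums, controlled through Hahn–Banach functionals dominated by a single `p`. -/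

/-- Convergence of `u` to `x` along `l` with respect to every seminorm in `Γ`. -/
def SeminormTendsto {ι : Type*} (Γ : Set (Seminorm 𝕜 X)) (u : ι → X) (l : Filter ι) (x : X) :
    Prop :=
  ∀ p ∈ Γ, Tendsto (fun i => p (u i - x)) l (𝓝 0)

/-- The norm is the supremum of the seminorms in `Γ`. -/
def IsNorming (Γ : Set (Seminorm 𝕜 X)) : Prop :=
  ∀ x : X, IsLUB {r : ℝ | ∃ p ∈ Γ, r = p x} ‖x‖

/-- Norm-bounded sequences that are Cauchy for every seminorm in `Γ` converge for all of them. -/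
def IsBoundedlyComplete (Γ : Set (Seminorm 𝕜 X)) : Prop :=
  ∀ u : ℕ → X, NormBounded u →
    (∀ p ∈ Γ, Tendsto (fun mn : ℕ × ℕ => p (u mn.1 - u mn.2)) atTop (𝓝 0)) →
    ∃ x : X, SeminormTendsto Γ u atTop x

/-! ### Translating the topology into seminorms -/

section Topology

variable {τ : AuxTopology X} {Γ : Set (Seminorm 𝕜 X)}

/-- A polynormable topology is described by all its continuous seminorms. Those in `Γ` are among
them, and conversely the ball of any continuous seminorm contains a ball of a single `p ∈ Γ`. -/
theorem tendsto_nhds_iff_seminormTendsto (hτ : @PolynormableSpace 𝕜 X _ _ _ τ.top)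
    (hΓ : IsFundamentalSystem τ Γ) {ι : Type*} {u : ι → X} {l : Filter ι} {x : X} :
    Tendsto u l (@nhds X τ.top x) ↔ SeminormTendsto Γ u l x := by
  have hW := @PolynormableSpace.withSeminorms 𝕜 X _ _ _ τ.top hτ
  rw [@WithSeminorms.tendsto_nhds 𝕜 X _ _ _ _ _ τ.top _ hW]
  constructor
  · intro h p hp
    rw [Metric.tendsto_nhds]
    intro ε hε
    filter_upwards [h ⟨p, hΓ.continuous p hp⟩ ε hε] with i hi
    rw [Real.dist_eq, sub_zero, abs_of_nonneg (apply_nonneg p _)]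
    exact hi
  · rintro h ⟨q, hq⟩ ε hε
    have hU : {y : X | q y < ε} ∈ @nhds X τ.top 0 := by
      have h0 : Tendsto q (@nhds X τ.top 0) (𝓝 (q 0)) := @Continuous.tendsto X ℝ τ.top _ q hq 0
      rw [map_zero] at h0
      exact h0.eventually_lt_const hε
    obtain ⟨p, hp, δ, hδ, hsub⟩ := hΓ.exists_ball_subset _ hU
    filter_upwards [(h p hp).eventually_lt_const hδ] with i hi
    exact hsub hi

theorem isBoundedlyComplete_of_isFundamentalSystem (hτ : IsBiAdmissible 𝕜 τ)
    (hΓ : IsFundamentalSystem τ Γ) : IsBoundedlyComplete Γ := by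
  intro u hu hc
  obtain ⟨x, hx⟩ := hτ.seqComplete u hu (by
    rw [tendsto_nhds_iff_seminormTendsto hτ.locallyConvex hΓ]
    intro p hp
    simpa using hc p hp)
  exact ⟨x, (tendsto_nhds_iff_seminormTendsto hτ.locallyConvex hΓ).1 hx⟩

end Topology

/-! ### Calculus of seminormwise limits -/

section Seminorms

variable {Γ : Set (Seminorm 𝕜 X)} {ι : Type*} {l : Filter ι} {u v : ι → X} {x y : X}

theorem IsNorming.le_norm (hN : IsNorming Γ) {p : Seminorm 𝕜 X} (hp : p ∈ Γ) (x : X) :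
    p x ≤ ‖x‖ :=
  (hN x).1 ⟨p, hp, rfl⟩

theorem IsNorming.norm_le (hN : IsNorming Γ) {C : ℝ} (h : ∀ p ∈ Γ, p x ≤ C) : ‖x‖ ≤ C := by
  refine (hN x).2 ?_
  rintro r ⟨p, hp, rfl⟩
  exact h p hp

theorem IsNorming.eq_of_forall_le (hN : IsNorming Γ)
    (h : ∀ p ∈ Γ, p (x - y) ≤ 0) : x = y := by
  have := hN.norm_le h
  rwa [norm_le_zero_iff, sub_eq_zero] at this

namespace SeminormTendsto

theorem tendsto_seminorm (h : SeminormTendsto Γ u l x) {p : Seminorm 𝕜 X} (hp : p ∈ Γ) :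
    Tendsto (fun i => p (u i)) l (𝓝 (p x)) := by
  rw [tendsto_iff_norm_sub_tendsto_zero]
  exact squeeze_zero (fun _ => norm_nonneg _) (fun i => abs_sub_map_le_sub p _ _) (h p hp)

protected theorem add (h : SeminormTendsto Γ u l x) (h' : SeminormTendsto Γ v l y) :
    SeminormTendsto Γ (fun i => u i + v i) l (x + y) := by
  intro p hp
  have := (h p hp).add (h' p hp)
  rw [add_zero] at this
  refine squeeze_zero (fun _ => apply_nonneg p _) (fun i => ?_) this
  rw [add_sub_add_comm]
  exact map_add_le_add p _ _

protected theorem smul {c : ι → 𝕜} {a : 𝕜} (hc : Tendsto c l (𝓝 a))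
    (h : SeminormTendsto Γ u l x) : SeminormTendsto Γ (fun i => c i • u i) l (a • x) := by
  intro p hp
  have h1 := (hc.norm.mul (h p hp)).add
    ((tendsto_iff_norm_sub_tendsto_zero.1 hc).mul_const (p x))
  rw [mul_zero, zero_mul, add_zero] at h1
  refine squeeze_zero (fun _ => apply_nonneg p _) (fun i => ?_) h1
  have : c i • u i - a • x = c i • (u i - x) + (c i - a) • x := by module
  rw [this, ← map_smul_eq_mul, ← map_smul_eq_mul]
  exact map_add_le_add p _ _

protected theorem const (x : X) : SeminormTendsto Γ (fun _ : ι => x) l x := by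
  intro p _
  simpa using tendsto_const_nhds

protected theorem sub (h : SeminormTendsto Γ u l x) (h' : SeminormTendsto Γ v l y) :
    SeminormTendsto Γ (fun i => u i - v i) l (x - y) := by
  have := h.add (h'.smul (tendsto_const_nhds (x := (-1 : 𝕜))))
  simpa [sub_eq_add_neg] using this

theorem unique [l.NeBot] (hN : IsNorming Γ) (h : SeminormTendsto Γ u l x)
    (h' : SeminormTendsto Γ u l y) : x = y := by
  refine hN.eq_of_forall_le fun p hp => ?_
  have := (h.sub h').tendsto_seminorm hp
  simp only [sub_self, map_zero] at this
  exact (tendsto_nhds_unique this tendsto_const_nhds).le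

theorem cauchy {u : ℕ → X} (h : SeminormTendsto Γ u atTop x) {p : Seminorm 𝕜 X} (hp : p ∈ Γ) :
    Tendsto (fun mn : ℕ × ℕ => p (u mn.1 - u mn.2)) atTop (𝓝 0) := by
  rw [← prod_atTop_atTop_eq]
  have h1 : SeminormTendsto Γ (fun mn : ℕ × ℕ => u mn.1) (atTop ×ˢ atTop) x :=
    fun p hp => (h p hp).comp tendsto_fst
  have h2 : SeminormTendsto Γ (fun mn : ℕ × ℕ => u mn.2) (atTop ×ˢ atTop) x :=
    fun p hp => (h p hp).comp tendsto_snd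
  simpa using (h1.sub h2).tendsto_seminorm hp

end SeminormTendsto

/-- A functional dominated by `p` that attains `p` at `x`. -/
theorem exists_functional_eq_seminorm (p : Seminorm 𝕜 X) (x : X) :
    ∃ φ : X →ₗ[𝕜] 𝕜, φ x = (p x : 𝕜) ∧ ∀ y, ‖φ y‖ ≤ p y := by
  by_cases hx : x = 0
  · exact ⟨0, by simp [hx], fun y => by simp⟩
  · have happ : ∀ (c : 𝕜) (y : Submodule.span 𝕜 {x}), (y : X) = c • x →
        (LinearEquiv.toSpanNonzeroSingleton 𝕜 X x hx).symm y = c := by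
      intro c y hy
      rw [LinearEquiv.symm_apply_eq]
      exact Subtype.ext hy
    obtain ⟨g, hg, hle⟩ := Module.Dual.exists_extension_of_le_seminorm
      (Submodule.span 𝕜 {x})
      ((p x : 𝕜) • ((LinearEquiv.toSpanNonzeroSingleton 𝕜 X x hx).symm :
        Submodule.span 𝕜 {x} →ₗ[𝕜] 𝕜)) (p := p) (by
        intro y
        obtain ⟨c, hc⟩ := Submodule.mem_span_singleton.1 y.2
        rw [LinearMap.smul_apply, LinearEquiv.coe_coe, happ c y hc.symm, ← hc, map_smul_eq_mul,
          smul_eq_mul, norm_mul, RCLike.norm_ofReal, abs_of_nonneg (apply_nonneg p x), mul_comm])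
    refine ⟨g, ?_, hle⟩
    have := hg ⟨x, Submodule.mem_span_singleton_self x⟩
    rw [LinearMap.smul_apply, LinearEquiv.coe_coe, happ 1 _ (one_smul 𝕜 x).symm, smul_eq_mul,
      mul_one] at this
    exact this

end Seminorms

/-! ### Resolvents of dissipative operators -/

section Resolvent

/-- `l - A` is bounded below by `l` for every seminorm in `Γ` and every `l > 0`. -/
def IsDissipativeFor (Γ : Set (Seminorm 𝕜 X)) (A : X →ₗ.[𝕜] X) : Prop :=
  ∀ l : ℝ, 0 < l → ∀ p ∈ Γ, ∀ x : A.domain, l * p (x : X) ≤ p ((l : 𝕜) • (x : X) - A x)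

/-- The range of `l - A` is the whole space. -/
def IsOntoAt (A : X →ₗ.[𝕜] X) (l : ℝ) : Prop :=
  ∀ y : X, ∃ x : A.domain, (l : 𝕜) • (x : X) - A x = y

/-- `R` is the inverse of `l - A`. -/
structure IsResolvent (A : X →ₗ.[𝕜] X) (l : ℝ) (R : X →L[𝕜] X) : Prop where
  right_inv : ∀ y : X, ∃ h : R y ∈ A.domain, (l : 𝕜) • R y - A ⟨R y, h⟩ = y
  left_inv : ∀ x : A.domain, R ((l : 𝕜) • (x : X) - A x) = x

variable {Γ : Set (Seminorm 𝕜 X)} {A : X →ₗ.[𝕜] X} {l m : ℝ} {R R' : X →L[𝕜] X}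

theorem IsDissipativeFor.norm_le (hA : IsDissipativeFor Γ A) (hN : IsNorming Γ) (hl : 0 < l)
    (x : A.domain) : ‖(x : X)‖ ≤ l⁻¹ * ‖(l : 𝕜) • (x : X) - A x‖ := by
  refine hN.norm_le fun p hp => ?_
  rw [inv_mul_eq_div, le_div_iff₀' hl]
  exact (hA l hl p hp x).trans (hN.le_norm hp _)

theorem IsDissipativeFor.exists_isResolvent (hA : IsDissipativeFor Γ A) (hN : IsNorming Γ)
    (hl : 0 < l) (hs : IsOntoAt A l) : ∃ R : X →L[𝕜] X, IsResolvent A l R := by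
  let F : A.domain →ₗ[𝕜] X := (l : 𝕜) • A.domain.subtype - A.toFun
  have hF : ∀ x : A.domain, F x = (l : 𝕜) • (x : X) - A x := fun x => rfl
  have hinj : Function.Injective F := by
    rw [← LinearMap.ker_eq_bot, LinearMap.ker_eq_bot']
    intro x hx
    have := hA.norm_le hN hl x
    rw [← hF, hx, norm_zero, mul_zero, norm_le_zero_iff] at this
    exact Subtype.ext this
  let e := LinearEquiv.ofBijective F ⟨hinj, hs⟩
  have he : ∀ y, (l : 𝕜) • ((e.symm y : A.domain) : X) - A (e.symm y) = y :=
    fun y => e.apply_symm_apply y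
  refine ⟨(A.domain.subtype ∘ₗ e.symm.toLinearMap).mkContinuous l⁻¹ fun y => ?_,
    fun y => ⟨(e.symm y).2, he y⟩, fun x => ?_⟩
  · have := hA.norm_le hN hl (e.symm y)
    rwa [he] at this
  · exact congrArg Subtype.val (e.symm_apply_apply x)

/-- The resolvent identity, obtained by applying `R` to `(l - A) R' y = y + (l - m) R' y`. -/
theorem IsResolvent.sub_eq (h : IsResolvent A l R) (h' : IsResolvent A m R') (y : X) :
    R y - R' y = ((m : 𝕜) - l) • R (R' y) := by
  obtain ⟨hd, hy⟩ := h'.right_inv y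
  have h1 := h.left_inv ⟨R' y, hd⟩
  have h2 : (l : 𝕜) • R' y - A ⟨R' y, hd⟩ = y + ((l : 𝕜) - m) • R' y := by
    linear_combination (norm := module) hy
  rw [h2, map_add, map_smul] at h1
  linear_combination (norm := module) h1

theorem IsResolvent.comm (h : IsResolvent A l R) (h' : IsResolvent A m R') (y : X) :
    R (R' y) = R' (R y) := by
  by_cases hlm : l = m
  · subst hlm
    have : R = R' := by
      ext z
      have := h.sub_eq h' z
      rwa [sub_self, zero_smul, sub_eq_zero] at this
    rw [this]
  · have h1 := h.sub_eq h' y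
    have h2 := h'.sub_eq h y
    have h3 : ((m : 𝕜) - l) ≠ 0 := by
      rw [sub_ne_zero]
      exact fun h => hlm (RCLike.ofReal_injective h).symm
    refine smul_right_injective X h3 ?_
    change ((m : 𝕜) - l) • R (R' y) = ((m : 𝕜) - l) • R' (R y)
    rw [← h1, ← neg_sub (R' y), h2, ← neg_smul, neg_sub]

theorem IsResolvent.seminorm_le (hA : IsDissipativeFor Γ A) (hl : 0 < l)
    (h : IsResolvent A l R) {p : Seminorm 𝕜 X} (hp : p ∈ Γ) (y : X) : l * p (R y) ≤ p y := by
  obtain ⟨hd, hy⟩ := h.right_inv y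
  have := hA l hl p hp ⟨R y, hd⟩
  rwa [hy] at this

/-- A perturbation `1 - S` of the identity with `‖S‖ < 1` is onto. -/
theorem exists_sub_apply_eq [CompleteSpace X] (S : X →L[𝕜] X) (hS : ‖S‖ < 1) (y : X) :
    ∃ z, z - S z = y := by
  let u := Units.oneSub S hS
  refine ⟨(↑u⁻¹ : X →L[𝕜] X) y, ?_⟩
  have h : (u : X →L[𝕜] X) * (↑u⁻¹ : X →L[𝕜] X) = 1 := u.mul_inv
  exact congrArg (fun f : X →L[𝕜] X => f y) h

/-- On the domain, `m - A = (1 - (l - m) R) (l - A)`, and `‖(l - m) R‖ ≤ |l - m| / l < 1` in the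
stated range of `m`. -/
theorem IsDissipativeFor.isOntoAt_of_lt [CompleteSpace X] (hA : IsDissipativeFor Γ A)
    (hN : IsNorming Γ) (hl : 0 < l) (hs : IsOntoAt A l) (hm : 0 < m) (hml : m < 2 * l) :
    IsOntoAt A m := by
  obtain ⟨R, hR⟩ := hA.exists_isResolvent hN hl hs
  have hRn : ‖R‖ ≤ l⁻¹ := by
    refine R.opNorm_le_bound (inv_nonneg.2 hl.le) fun y => ?_
    obtain ⟨hd, hy⟩ := hR.right_inv y
    have := hA.norm_le hN hl ⟨R y, hd⟩
    rwa [hy] at this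
  intro y
  obtain ⟨z, hz⟩ := exists_sub_apply_eq (((l - m : ℝ) : 𝕜) • R) (by
    rw [norm_smul, RCLike.norm_ofReal]
    calc |l - m| * ‖R‖ ≤ |l - m| * l⁻¹ := by gcongr
      _ < l * l⁻¹ := by
        have : |l - m| < l := abs_lt.2 ⟨by linarith, by linarith⟩
        gcongr
      _ = 1 := mul_inv_cancel₀ hl.ne') y
  obtain ⟨hd, hy⟩ := hR.right_inv z
  refine ⟨⟨R z, hd⟩, ?_⟩
  rw [smul_apply] at hz
  rw [← hz]
  nth_rewrite 3 [← hy]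
  rw [RCLike.ofReal_sub]
  module

theorem IsDissipativeFor.isOntoAt [CompleteSpace X] (hA : IsDissipativeFor Γ A)
    (hN : IsNorming Γ) (hl : 0 < l) (hs : IsOntoAt A l) (hm : 0 < m) : IsOntoAt A m := by
  -- Any ratio strictly between 1 and 2 lets the parameter climb past `m`; a single step then comes
  -- down to `m`, however small it is.
  have key : ∀ n : ℕ, IsOntoAt A (l * (3 / 2) ^ n) := by
    intro n
    induction n with
    | zero => simpa using hs
    | succ n ih =>
      have : 0 < l * (3 / 2) ^ n := by positivity
      exact hA.isOntoAt_of_lt hN this ih (by positivity) (by rw [pow_succ]; linarith)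
  obtain ⟨n, hn⟩ := pow_unbounded_of_one_lt (m / l) (by norm_num : (1 : ℝ) < 3 / 2)
  have : 0 < l * (3 / 2) ^ n := by positivity
  refine hA.isOntoAt_of_lt hN this (key n) hm ?_
  rw [div_lt_iff₀ hl] at hn
  linarith

theorem IsResolvent.smul_apply_sub (h : IsResolvent A l R) (x : A.domain) :
    (l : 𝕜) • R x - x = R (A x) := by
  have := h.left_inv x
  rw [map_sub, map_smul] at this
  linear_combination (norm := module) this

/-- `l R(l) → 1` as `l → ∞`, for each seminorm. -/
theorem seminormTendsto_smul_resolvent (hA : IsDissipativeFor Γ A)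
    {r : ℕ → ℝ} (hr : ∀ n, 0 < r n) (hr' : Tendsto r atTop atTop) {R : ℕ → X →L[𝕜] X}
    (hR : ∀ n, IsResolvent A (r n) (R n)) {y : X}
    (hy : ∃ u : ℕ → X, (∀ n, u n ∈ A.domain) ∧ SeminormTendsto Γ u atTop y) :
    SeminormTendsto Γ (fun n => (r n : 𝕜) • R n y) atTop y := by
  intro p hp
  obtain ⟨u, hu, huy⟩ := hy
  have hK : ∀ n z, p ((r n : 𝕜) • R n z) ≤ p z := by
    intro n z
    rw [map_smul_eq_mul, RCLike.norm_ofReal, abs_of_pos (hr n)]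
    exact (hR n).seminorm_le hA (hr n) hp z
  rw [Metric.tendsto_nhds]
  intro ε hε
  -- On the domain, `r R u - u = R (A u)` has `p`-size at most `p (A u) / r`. Since `r R` is a
  -- `p`-contraction, replacing `y` by `u k` costs only `2 p (u k - y)`.
  obtain ⟨k, hk⟩ := ((huy p hp).eventually_lt_const (show 0 < ε / 3 by positivity)).exists
  have hlim : Tendsto (fun n => (r n)⁻¹ * p (A ⟨u k, hu k⟩)) atTop (𝓝 0) := by
    simpa using hr'.inv_tendsto_atTop.mul_const (p (A ⟨u k, hu k⟩))
  filter_upwards [hlim.eventually_lt_const (show 0 < ε / 3 by positivity)] with n hn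
  rw [Real.dist_eq, sub_zero, abs_of_nonneg (apply_nonneg p _)]
  have h1 : (r n : 𝕜) • R n y - y =
      (r n : 𝕜) • R n (y - u k) + (R n (A ⟨u k, hu k⟩) + (u k - y)) := by
    rw [← (hR n).smul_apply_sub ⟨u k, hu k⟩, map_sub, smul_sub]
    abel
  have h2 : p (R n (A ⟨u k, hu k⟩)) ≤ (r n)⁻¹ * p (A ⟨u k, hu k⟩) := by
    rw [inv_mul_eq_div, le_div_iff₀' (hr n)]
    exact (hR n).seminorm_le hA (hr n) hp _
  have h3 := hK n (y - u k)
  rw [map_sub_rev p] at h3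
  rw [h1]
  have h4 := map_add_le_add p ((r n : 𝕜) • R n (y - u k)) (R n (A ⟨u k, hu k⟩) + (u k - y))
  have h5 := map_add_le_add p (R n (A ⟨u k, hu k⟩)) (u k - y)
  rw [map_sub_rev p] at h3
  rw [map_sub_rev p] at h3
  linarith

end Resolvent

/-! ### Groups generated by bounded operators -/

section ExpGroup

/-- The uniformly continuous group `t ↦ exp (t B)` generated by a bounded operator `B`. -/
noncomputable def expGroup (B : X →L[𝕜] X) (t : ℝ) : X →L[𝕜] X :=
  NormedSpace.exp ((t : 𝕜) • B)

variable {Γ : Set (Seminorm 𝕜 X)} {p : Seminorm 𝕜 X} {B C K : X →L[𝕜] X}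

@[simp]
theorem expGroup_zero (B : X →L[𝕜] X) : expGroup B 0 = 1 := by
  simp [expGroup]

theorem commute_expGroup (h : Commute B C) (s t : ℝ) :
    Commute (expGroup B s) (expGroup C t) :=
  ((h.smul_left _).smul_right _).exp

theorem continuous_seminorm_of_le_norm (hp : ∀ x, p x ≤ ‖x‖) : Continuous p :=
  Seminorm.continuous_of_le (q := normSeminorm 𝕜 X) continuous_norm hp

theorem exp_ofReal_smul_one (a : ℝ) :
    NormedSpace.exp ((a : 𝕜) • (1 : X →L[𝕜] X)) = ((Real.exp a : ℝ) : 𝕜) • 1 := by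
  have h1 : ((Real.exp a : ℝ) : 𝕜) = NormedSpace.exp (a : 𝕜) := by
    rw [Real.exp_eq_exp_ℝ]
    exact NormedSpace.algebraMap_exp_comm (𝕂 := ℝ) (𝔸 := 𝕜) a
  rw [h1, ← Algebra.algebraMap_eq_smul_one, ← Algebra.algebraMap_eq_smul_one,
    NormedSpace.algebraMap_exp_comm]

variable [CompleteSpace X]

theorem expGroup_add (B : X →L[𝕜] X) (s t : ℝ) :
    expGroup B (s + t) = expGroup B s * expGroup B t := by
  let _ := NormedAlgebra.restrictScalars ℚ 𝕜 (X →L[𝕜] X)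
  rw [expGroup, RCLike.ofReal_add, add_smul,
    NormedSpace.exp_add_of_commute (((Commute.refl B).smul_left _).smul_right _)]
  rfl

theorem expGroup_natCast_mul (B : X →L[𝕜] X) (N : ℕ) (t : ℝ) :
    expGroup B (N * t) = expGroup B t ^ N := by
  induction N with
  | zero => simp
  | succ N ih => rw [Nat.cast_succ, add_mul, one_mul, expGroup_add, ih, pow_succ]

/-- The derivative of the exponential at 0, sampled at steps `t / N`. It converts telescoping
estimates over `N` steps into estimates in terms of `B`, with no vector-valued integral. -/
theorem tendsto_natCast_smul_expGroup_sub (B : X →L[𝕜] X) (t : ℝ) (x : X) :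
    Tendsto (fun N : ℕ => (N : 𝕜) • (expGroup B (t / N) x - x)) atTop (𝓝 ((t : 𝕜) • B x)) := by
  have h := (hasDerivAt_exp_smul_const (𝕂 := 𝕜) ((t : 𝕜) • B) 0).tendsto_slope_zero
  have hN : Tendsto (fun N : ℕ => (N : 𝕜)⁻¹) atTop (𝓝[≠] 0) := by
    refine tendsto_nhdsWithin_iff.2 ⟨tendsto_inv_atTop_nhds_zero_nat, ?_⟩
    filter_upwards [eventually_ne_atTop 0] with N hN
    exact inv_ne_zero (Nat.cast_ne_zero.2 hN)
  have h1 := ((ContinuousLinearMap.apply 𝕜 X x).continuous.tendsto _).comp (h.comp hN)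
  simp only [zero_smul, NormedSpace.exp_zero, one_mul, ContinuousLinearMap.apply_apply,
    smul_apply] at h1
  refine h1.congr fun N => ?_
  simp [expGroup, smul_smul, div_eq_inv_mul]

theorem seminorm_exp_smul_le (hp : ∀ x, p x ≤ ‖x‖) (hK : ∀ x, p (K x) ≤ p x) {c : ℝ}
    (hc : 0 ≤ c) (x : X) : p (NormedSpace.exp ((c : 𝕜) • K) x) ≤ Real.exp c * p x := by
  have hpow : ∀ (n : ℕ) (x : X), p ((K ^ n) x) ≤ p x := by
    intro n
    induction n with
    | zero => intro x; simp
    | succ n ih => intro x; rw [pow_succ']; exact (hK _).trans (ih x)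
  have hs := NormedSpace.exp_series_hasSum_exp' (𝕂 := 𝕜) ((c : 𝕜) • K)
  have hs' := ((ContinuousLinearMap.apply 𝕜 X x).hasSum hs).tendsto_sum_nat
  refine le_of_tendsto (((continuous_seminorm_of_le_norm hp).tendsto _).comp hs') (Eventually.of_forall fun n => ?_)
  calc p (∑ i ∈ Finset.range n,
        ContinuousLinearMap.apply 𝕜 X x ((i.factorial : 𝕜)⁻¹ • ((c : 𝕜) • K) ^ i))
      ≤ ∑ i ∈ Finset.range n,
        p (ContinuousLinearMap.apply 𝕜 X x ((i.factorial : 𝕜)⁻¹ • ((c : 𝕜) • K) ^ i)) :=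
        Finset.le_sum_of_subadditive p (map_zero p).le (map_add_le_add p) _ _
    _ ≤ ∑ i ∈ Finset.range n, c ^ i / i.factorial * p x := by
        refine Finset.sum_le_sum fun i _ => ?_
        rw [ContinuousLinearMap.apply_apply, smul_pow, smul_smul, smul_apply, map_smul_eq_mul]
        rw [norm_mul, norm_inv, norm_pow, RCLike.norm_ofReal, RCLike.norm_natCast,
          abs_of_nonneg hc, ← div_eq_inv_mul]
        exact mul_le_mul_of_nonneg_left (hpow i x) (by positivity)
    _ = (∑ i ∈ Finset.range n, c ^ i / i.factorial) * p x := (Finset.sum_mul _ _ _).symm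
    _ ≤ Real.exp c * p x :=
        mul_le_mul_of_nonneg_right (Real.sum_le_exp_of_nonneg hc n) (apply_nonneg p x)

/-- If `K` is a `p`-contraction, then so is `exp (t a (K - 1))` for `a, t ≥ 0`. -/
theorem seminorm_expGroup_le (hp : ∀ x, p x ≤ ‖x‖) (hK : ∀ x, p (K x) ≤ p x) {a : ℝ}
    (ha : 0 ≤ a) {t : ℝ} (ht : 0 ≤ t) (x : X) :
    p (expGroup ((a : 𝕜) • (K - 1)) t x) ≤ p x := by
  let _ := NormedAlgebra.restrictScalars ℚ 𝕜 (X →L[𝕜] X)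
  -- Splitting off the scalar part gives a factor `exp (-ta)`, which cancels the growth `exp (ta)`
  -- of the part with `K`.
  have h : (t : 𝕜) • (a : 𝕜) • (K - 1) =
      ((-(t * a) : ℝ) : 𝕜) • (1 : X →L[𝕜] X) + ((t * a : ℝ) : 𝕜) • K := by
    push_cast
    module
  rw [expGroup, h, NormedSpace.exp_add_of_commute ((Commute.one_left _).smul_left _),
    exp_ofReal_smul_one, smul_one_mul, smul_apply, map_smul_eq_mul, RCLike.norm_ofReal,
    abs_of_pos (Real.exp_pos _)]
  calc Real.exp (-(t * a)) * p (NormedSpace.exp (((t * a : ℝ) : 𝕜) • K) x)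
      ≤ Real.exp (-(t * a)) * (Real.exp (t * a) * p x) := by
        gcongr
        exact seminorm_exp_smul_le hp hK (mul_nonneg ht ha) x
    _ = p x := by rw [← mul_assoc, ← Real.exp_add]; simp

end ExpGroup

/-! ### Telescoping estimates for powers of contractions -/

section Telescoping

variable {p : Seminorm 𝕜 X} {S T : X →L[𝕜] X}

theorem seminorm_pow_le (hS : ∀ x, p (S x) ≤ p x) (n : ℕ) (x : X) : p ((S ^ n) x) ≤ p x := by
  induction n generalizing x with
  | zero => simp
  | succ n ih => rw [pow_succ']; exact (hS _).trans (ih x)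

/-- Telescoping by `S^(N+1) - T^(N+1) = S^N (S - T) + (S^N - T^N) T`; commutation turns `(S - T) T`
into `T (S - T)`, where contractivity removes `T`. -/
theorem seminorm_pow_sub_pow_le (hS : ∀ x, p (S x) ≤ p x) (hT : ∀ x, p (T x) ≤ p x)
    (hST : Commute S T) (N : ℕ) (x : X) :
    p ((S ^ N) x - (T ^ N) x) ≤ N * p (S x - T x) := by
  induction N generalizing x with
  | zero => simp
  | succ N ih =>
    have h : (S ^ (N + 1)) x - (T ^ (N + 1)) x =
        (S ^ N) (S x - T x) + ((S ^ N) (T x) - (T ^ N) (T x)) := by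
      rw [pow_succ, pow_succ, map_sub]
      change (S ^ N) (S x) - (T ^ N) (T x) = _
      abel
    have hc : S (T x) = T (S x) := congrArg (fun f : X →L[𝕜] X => f x) hST.eq
    have h1 := ih (T x)
    rw [hc, ← map_sub] at h1
    have h2 : (N : ℝ) * p (T (S x - T x)) ≤ N * p (S x - T x) := by
      gcongr
      exact hT _
    rw [h, Nat.cast_succ]
    linarith [map_add_le_add p ((S ^ N) (S x - T x)) ((S ^ N) (T x) - (T ^ N) (T x)),
      seminorm_pow_le hS N (S x - T x)]

/-- A discrete form of `exp (tB) x - x - t B x = ∫ (exp (sB) - 1) B x ds` over `[0, t]`, intended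
for `S = exp ((t/N) B)`, `y = B x` and `c = t / N`. Replacing `S x - x` by `c y` costs `2 p (S x - x
- c y)` per step. -/
theorem seminorm_pow_sub_one_sub_le {ε : ℝ} (N : ℕ) {x y : X}
    (h : ∀ k < N, p ((S ^ k) y - y) ≤ ε) (hS : ∀ x, p (S x) ≤ p x) (c : ℝ) (hc : 0 ≤ c) :
    p ((S ^ N) x - x - (N : 𝕜) • (S x - x)) ≤ N * (2 * p (S x - x - (c : 𝕜) • y) + c * ε) := by
  induction N with
  | zero => simp
  | succ N ih =>
    have h0 : (S ^ (N + 1)) x = (S ^ N) (S x) := by rw [pow_succ]; rfl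
    have h1 : (S ^ (N + 1)) x - x - ((N + 1 : ℕ) : 𝕜) • (S x - x) =
        ((S ^ N) x - x - (N : 𝕜) • (S x - x)) + ((S ^ N) (S x - x - (c : 𝕜) • y)
          - (S x - x - (c : 𝕜) • y) + (c : 𝕜) • ((S ^ N) y - y)) := by
      rw [h0]
      simp only [map_sub, map_smul]
      push_cast
      module
    have h2 := h N (Nat.lt_succ_self N)
    have h3 := ih fun k hk => h k (hk.trans (Nat.lt_succ_self N))
    have h4 : p ((c : 𝕜) • ((S ^ N) y - y)) ≤ c * ε := by
      rw [map_smul_eq_mul, RCLike.norm_ofReal, abs_of_nonneg hc]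
      gcongr
    have h5 := seminorm_pow_le hS N (S x - x - (c : 𝕜) • y)
    rw [h1, Nat.cast_succ]
    linarith [map_add_le_add p ((S ^ N) x - x - (N : 𝕜) • (S x - x))
        ((S ^ N) (S x - x - (c : 𝕜) • y) - (S x - x - (c : 𝕜) • y) + (c : 𝕜) • ((S ^ N) y - y)),
      map_add_le_add p ((S ^ N) (S x - x - (c : 𝕜) • y) - (S x - x - (c : 𝕜) • y))
        ((c : 𝕜) • ((S ^ N) y - y)),
      map_sub_le_add p ((S ^ N) (S x - x - (c : 𝕜) • y)) (S x - x - (c : 𝕜) • y)]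

end Telescoping

/-! ### First and second order estimates for the groups -/

section ExpGroupEstimates

variable [CompleteSpace X] {p : Seminorm 𝕜 X} {B C : X →L[𝕜] X}

theorem expGroup_div_pow (B : X →L[𝕜] X) (t : ℝ) {N : ℕ} (hN : N ≠ 0) :
    expGroup B (t / N) ^ N = expGroup B t := by
  rw [← expGroup_natCast_mul, mul_div_cancel₀ _ (Nat.cast_ne_zero.2 hN)]

/-- Cut `[0, t]` into `N` steps, telescope, and let `N → ∞`: `N` times the one-step difference tends
to `t (B x - C x)`. -/
theorem seminorm_expGroup_sub_expGroup_le (hp : ∀ x, p x ≤ ‖x‖)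
    (hB : ∀ t, 0 ≤ t → ∀ x, p (expGroup B t x) ≤ p x)
    (hC : ∀ t, 0 ≤ t → ∀ x, p (expGroup C t x) ≤ p x) (hBC : Commute B C) {t : ℝ} (ht : 0 ≤ t)
    (x : X) : p (expGroup B t x - expGroup C t x) ≤ t * p (B x - C x) := by
  have hlim : Tendsto (fun N : ℕ => (N : ℝ) * p (expGroup B (t / N) x - expGroup C (t / N) x))
      atTop (𝓝 (t * p (B x - C x))) := by
    have h1 := (tendsto_natCast_smul_expGroup_sub B t x).sub
      (tendsto_natCast_smul_expGroup_sub C t x)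
    rw [← smul_sub] at h1
    have h2 := ((continuous_seminorm_of_le_norm hp).tendsto _).comp h1
    rw [map_smul_eq_mul, RCLike.norm_ofReal, abs_of_nonneg ht] at h2
    refine h2.congr fun N => ?_
    rw [Function.comp_apply, ← smul_sub, sub_sub_sub_cancel_right, map_smul_eq_mul,
      RCLike.norm_natCast]
  refine ge_of_tendsto hlim ?_
  filter_upwards [eventually_ne_atTop 0] with N hN
  have h := seminorm_pow_sub_pow_le (hB (t / N) (by positivity)) (hC (t / N) (by positivity))
    (commute_expGroup hBC _ _) N x
  rwa [expGroup_div_pow B t hN, expGroup_div_pow C t hN] at h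

theorem seminorm_expGroup_sub_le (hp : ∀ x, p x ≤ ‖x‖)
    (hB : ∀ t, 0 ≤ t → ∀ x, p (expGroup B t x) ≤ p x) {t : ℝ} (ht : 0 ≤ t) (x : X) :
    p (expGroup B t x - x) ≤ t * p (B x) := by
  have h0 : ∀ t, expGroup (0 : X →L[𝕜] X) t = 1 := fun t => by simp [expGroup]
  have := seminorm_expGroup_sub_expGroup_le hp hB (C := 0) (fun t _ x => by simp [h0])
    (Commute.zero_right B) ht x
  simpa [h0] using this

theorem seminorm_expGroup_sub_sub_le (hp : ∀ x, p x ≤ ‖x‖)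
    (hB : ∀ t, 0 ≤ t → ∀ x, p (expGroup B t x) ≤ p x) {t ε : ℝ} (ht : 0 ≤ t) (x : X)
    (h : ∀ s, 0 ≤ s → s ≤ t → p (expGroup B s (B x) - B x) ≤ ε) :
    p (expGroup B t x - x - (t : 𝕜) • B x) ≤ t * ε := by
  have h1 := tendsto_natCast_smul_expGroup_sub B t x
  have hcont := continuous_seminorm_of_le_norm hp
  have hL : Tendsto (fun N : ℕ => p (expGroup B t x - x - (N : 𝕜) • (expGroup B (t / N) x - x)))
      atTop (𝓝 (p (expGroup B t x - x - (t : 𝕜) • B x))) :=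
    (hcont.tendsto _).comp (tendsto_const_nhds.sub h1)
  have hR : Tendsto (fun N : ℕ => 2 * p ((N : 𝕜) • (expGroup B (t / N) x - x) - (t : 𝕜) • B x)
      + t * ε) atTop (𝓝 (t * ε)) := by
    have h2 := (hcont.tendsto _).comp (h1.sub_const ((t : 𝕜) • B x))
    rw [sub_self, map_zero] at h2
    simpa using (h2.const_mul 2).add_const (t * ε)
  refine le_of_tendsto_of_tendsto hL hR ?_
  filter_upwards [eventually_ne_atTop 0] with N hN
  have hN' : (N : ℝ) ≠ 0 := Nat.cast_ne_zero.2 hN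
  have hN0 : (0 : ℝ) < N := by positivity
  have h3 := seminorm_pow_sub_one_sub_le (𝕜 := 𝕜) (p := p) (S := expGroup B (t / N)) (ε := ε) N
    (x := x) (y := B x) (fun k hk => by
      rw [← expGroup_natCast_mul]
      refine h _ (by positivity) ?_
      rw [mul_div_assoc', div_le_iff₀ hN0, mul_comm]
      have : (k : ℝ) ≤ N := by exact_mod_cast hk.le
      gcongr) (hB (t / N) (by positivity)) (t / N) (by positivity)
  rw [expGroup_div_pow B t hN] at h3
  refine h3.trans (le_of_eq ?_)
  have h4 : (N : 𝕜) • (expGroup B (t / N) x - x) - (t : 𝕜) • B x =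
      (N : 𝕜) • (expGroup B (t / N) x - x - ((t / N : ℝ) : 𝕜) • B x) := by
    rw [smul_sub (N : 𝕜) (_ - _), smul_smul]
    congr 2
    push_cast
    rw [mul_div_cancel₀ _ (Nat.cast_ne_zero.2 hN)]
  rw [h4, map_smul_eq_mul, RCLike.norm_natCast]
  field_simp

end ExpGroupEstimates

/-! ### Yosida approximation and the limit semigroup -/

section YosidaLimit

/-- The bounded operators `B n` approximate `A` on its domain, commute, and generate groups that
are contractive in positive time for every seminorm in `Γ`; the domain of `A` is sequentially
dense. -/
structure IsContractiveApproximation (Γ : Set (Seminorm 𝕜 X)) (A : X →ₗ.[𝕜] X)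
    (B : ℕ → X →L[𝕜] X) : Prop where
  commute : ∀ m n, Commute (B m) (B n)
  contractive : ∀ n, ∀ p ∈ Γ, ∀ t, 0 ≤ t → ∀ x, p (expGroup (B n) t x) ≤ p x
  tendsto : ∀ x : A.domain, SeminormTendsto Γ (fun n => B n x) atTop (A x)
  dense : ∀ x, ∃ u : ℕ → X, (∀ n, u n ∈ A.domain) ∧ SeminormTendsto Γ u atTop x

theorem IsDissipativeFor.exists_isContractiveApproximation [CompleteSpace X]
    {Γ : Set (Seminorm 𝕜 X)} {A : X →ₗ.[𝕜] X} (hA : IsDissipativeFor Γ A) (hN : IsNorming Γ)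
    (hD : ∀ x, ∃ u : ℕ → X, (∀ n, u n ∈ A.domain) ∧ SeminormTendsto Γ u atTop x) {l : ℝ}
    (hl : 0 < l) (hs : IsOntoAt A l) :
    ∃ B : ℕ → X →L[𝕜] X, IsContractiveApproximation Γ A B := by
  have hr : ∀ n : ℕ, (0 : ℝ) < n + 1 := fun n => by positivity
  have hr' : Tendsto (fun n : ℕ => (n : ℝ) + 1) atTop atTop :=
    tendsto_atTop_add_const_right _ _ tendsto_natCast_atTop_atTop
  choose R hR using fun n : ℕ => hA.exists_isResolvent hN (hr n) (hA.isOntoAt hN hl hs (hr n))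
  -- The Yosida approximations with parameter `r = n + 1`, positive for every index. On the domain
  -- they equal `r R (A x)`, which tends to `A x`.
  refine ⟨fun n => (((n : ℝ) + 1 : ℝ) : 𝕜) • ((((n : ℝ) + 1 : ℝ) : 𝕜) • R n - 1), ?_, ?_, ?_, hD⟩
  · intro m n
    have h : Commute (R m) (R n) := by
      ext y
      exact (hR m).comm (hR n) y
    exact ((((h.smul_left _).smul_right _).sub_left (Commute.one_left _)).sub_right
      (Commute.one_right _)).smul_left _ |>.smul_right _
  · intro n p hp t ht x
    refine seminorm_expGroup_le (hN.le_norm hp) (fun y => ?_) (hr n).le ht x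
    rw [smul_apply, map_smul_eq_mul, RCLike.norm_ofReal, abs_of_pos (hr n)]
    exact (hR n).seminorm_le hA (hr n) hp y
  · intro x
    have h := seminormTendsto_smul_resolvent hA hr hr' hR (hD (A x))
    refine (congrArg (fun f => SeminormTendsto Γ f atTop (A x)) (funext fun n => ?_)).mp h
    have := (hR n).smul_apply_sub x
    change _ = (((n : ℝ) + 1 : ℝ) : 𝕜) • ((((n : ℝ) + 1 : ℝ) : 𝕜) • R n (x : X) - x)
    rw [this]

theorem limit_expGroup_zero {Γ : Set (Seminorm 𝕜 X)} (hN : IsNorming Γ) {B : ℕ → X →L[𝕜] X}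
    {T : NNReal → X →L[𝕜] X}
    (hT : ∀ (t : NNReal) x, SeminormTendsto Γ (fun n => expGroup (B n) t x) atTop (T t x)) :
    T 0 = ContinuousLinearMap.id 𝕜 X := by
  ext x
  refine (hT 0 x).unique hN ?_
  simpa using SeminormTendsto.const x

namespace IsContractiveApproximation

variable {Γ : Set (Seminorm 𝕜 X)} {A : X →ₗ.[𝕜] X} {B : ℕ → X →L[𝕜] X} {T : NNReal → X →L[𝕜] X}

theorem seminorm_limit_le (hB : IsContractiveApproximation Γ A B)
    (hT : ∀ (t : NNReal) x, SeminormTendsto Γ (fun n => expGroup (B n) t x) atTop (T t x))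
    {p : Seminorm 𝕜 X} (hp : p ∈ Γ) (t : NNReal) (x : X) : p (T t x) ≤ p x :=
  le_of_tendsto ((hT t x).tendsto_seminorm hp)
    (Eventually.of_forall fun n => hB.contractive n p hp t t.2 x)

variable [CompleteSpace X]

theorem exists_seminormTendsto_expGroup (hB : IsContractiveApproximation Γ A B)
    (hN : IsNorming Γ) (hc : IsBoundedlyComplete Γ) {t : ℝ} (ht : 0 ≤ t) (x : X) :
    ∃ z, SeminormTendsto Γ (fun n => expGroup (B n) t x) atTop z := by
  refine hc _ ⟨‖x‖, fun n => hN.norm_le fun p hp =>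
    (hB.contractive n p hp t ht x).trans (hN.le_norm hp x)⟩ fun p hp => ?_
  obtain ⟨u, hu, hux⟩ := hB.dense x
  rw [Metric.tendsto_nhds]
  intro ε hε
  obtain ⟨k, hk⟩ := ((hux p hp).eventually_lt_const (show 0 < ε / 3 by positivity)).exists
  have h1 := ((hB.tendsto ⟨u k, hu k⟩).cauchy hp).const_mul t
  rw [mul_zero] at h1
  filter_upwards [h1.eventually_lt_const (show 0 < ε / 3 by positivity)] with mn hmn
  rw [Real.dist_eq, sub_zero, abs_of_nonneg (apply_nonneg p _)]
  -- Replacing `x` by the domain vector `u k` costs at most `2 p (u k - x)` by contractivity; at `u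
  -- k` the groups differ by at most `t p (B m (u k) - B n (u k))`, which is small because `B n (u
  -- k)` converges.
  have h2 : expGroup (B mn.1) t x - expGroup (B mn.2) t x =
      (expGroup (B mn.1) t (u k) - expGroup (B mn.2) t (u k)) -
        (expGroup (B mn.1) t (u k - x) - expGroup (B mn.2) t (u k - x)) := by
    simp only [map_sub]
    abel
  have h3 := seminorm_expGroup_sub_expGroup_le (hN.le_norm hp) (hB.contractive mn.1 p hp)
    (hB.contractive mn.2 p hp) (hB.commute _ _) ht (u k)
  rw [h2]
  linarith [map_sub_le_add p (expGroup (B mn.1) t (u k) - expGroup (B mn.2) t (u k))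
      (expGroup (B mn.1) t (u k - x) - expGroup (B mn.2) t (u k - x)),
    map_sub_le_add p (expGroup (B mn.1) t (u k - x)) (expGroup (B mn.2) t (u k - x)),
    hB.contractive mn.1 p hp t ht (u k - x), hB.contractive mn.2 p hp t ht (u k - x)]

theorem exists_limit (hB : IsContractiveApproximation Γ A B)
    (hN : IsNorming Γ) (hc : IsBoundedlyComplete Γ) :
    ∃ T : NNReal → X →L[𝕜] X,
      ∀ (t : NNReal) x, SeminormTendsto Γ (fun n => expGroup (B n) t x) atTop (T t x) := by
  choose T hT using fun (t : NNReal) x => hB.exists_seminormTendsto_expGroup hN hc t.2 x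
  refine ⟨fun t => LinearMap.mkContinuous
    { toFun := T t
      map_add' := fun x y => ?_
      map_smul' := fun c x => ?_ } 1 fun x => ?_, fun t x => hT t x⟩
  · refine (hT t (x + y)).unique hN ?_
    simpa only [map_add] using (hT t x).add (hT t y)
  · refine (hT t (c • x)).unique hN ?_
    simpa only [map_smul, RingHom.id_apply] using (hT t x).smul (tendsto_const_nhds (x := c))
  · rw [one_mul]
    refine hN.norm_le fun p hp => le_of_tendsto ((hT t x).tendsto_seminorm hp) ?_
    exact Eventually.of_forall fun n =>
      (hB.contractive n p hp t t.2 x).trans (hN.le_norm hp x)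

section Limit

variable (hB : IsContractiveApproximation Γ A B) (hN : IsNorming Γ)
  (hT : ∀ (t : NNReal) x, SeminormTendsto Γ (fun n => expGroup (B n) t x) atTop (T t x))

include hB hN hT

theorem limit_add (t s : NNReal) : T (t + s) = (T t).comp (T s) := by
  ext x
  refine (hT (t + s) x).unique hN fun p hp => ?_
  have h := (hT s x p hp).add (hT t (T s x) p hp)
  rw [add_zero] at h
  refine squeeze_zero (fun _ => apply_nonneg p _) (fun n => ?_) h
  have h1 : expGroup (B n) ((t + s : NNReal) : ℝ) x - (T t).comp (T s) x =
      expGroup (B n) t (expGroup (B n) s x - T s x) + (expGroup (B n) t (T s x) - T t (T s x)) := by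
    rw [NNReal.coe_add, expGroup_add, map_sub]
    change expGroup (B n) t (expGroup (B n) s x) - T t (T s x) = _
    abel
  rw [h1]
  exact (map_add_le_add p _ _).trans
    (add_le_add_left (hB.contractive n p hp t t.2 _) _)

/-- The estimate for the approximating groups survives the limit. It yields continuity at 0 and also
the bounded difference quotients required by the generator's domain. -/
theorem seminorm_limit_sub_le {p : Seminorm 𝕜 X} (hp : p ∈ Γ) (t : NNReal) (x : A.domain) :
    p (T t x - x) ≤ t * p (A x) :=
  le_of_tendsto_of_tendsto (((hT t x).sub (SeminormTendsto.const (x : X))).tendsto_seminorm hp)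
    (((hB.tendsto x).tendsto_seminorm hp).const_mul (t : ℝ))
    (Eventually.of_forall fun n =>
      seminorm_expGroup_sub_le (hN.le_norm hp) (hB.contractive n p hp) t.2 x)

theorem tendsto_limit_sub {p : Seminorm 𝕜 X} (hp : p ∈ Γ) (x : X) :
    Tendsto (fun t : NNReal => p (T t x - x)) (𝓝 0) (𝓝 0) := by
  obtain ⟨u, hu, hux⟩ := hB.dense x
  rw [Metric.tendsto_nhds]
  intro ε hε
  obtain ⟨k, hk⟩ := ((hux p hp).eventually_lt_const (show 0 < ε / 3 by positivity)).exists
  have h1 : Tendsto (fun t : NNReal => (t : ℝ) * p (A ⟨u k, hu k⟩)) (𝓝 0) (𝓝 0) := by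
    simpa using (NNReal.continuous_coe.tendsto 0).mul_const (p (A ⟨u k, hu k⟩))
  filter_upwards [h1.eventually_lt_const (show 0 < ε / 3 by positivity)] with t ht
  rw [Real.dist_eq, sub_zero, abs_of_nonneg (apply_nonneg p _)]
  have h2 : T t x - x = (T t (u k) - u k) - (T t (u k - x) - (u k - x)) := by
    rw [map_sub]
    abel
  rw [h2]
  linarith [map_sub_le_add p (T t (u k) - u k) (T t (u k - x) - (u k - x)),
    map_sub_le_add p (T t (u k - x)) (u k - x), hB.seminorm_limit_le hT hp t (u k - x),
    hB.seminorm_limit_sub_le hN hT hp t ⟨u k, hu k⟩]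

/-- For `t ≤ s`, `T s - T t = T t (T (s - t) - 1)` and `T t` is a `p`-contraction, so continuity
need only be checked at 0. -/
theorem seminorm_limit_sub_limit_le {p : Seminorm 𝕜 X} (hp : p ∈ Γ) (x : X) (s t : NNReal) :
    p (T s x - T t x) ≤ p (T (nndist s t) x - x) := by
  wlog hst : t ≤ s generalizing s t
  · rw [map_sub_rev p, nndist_comm]
    exact this t s (le_of_not_ge hst)
  · have h : s = t + nndist s t := by
      rw [NNReal.nndist_eq, tsub_eq_zero_of_le hst, max_eq_left zero_le, add_tsub_cancel_of_le hst]
    have h1 : T s x = T t (T (nndist s t) x) := by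
      nth_rewrite 1 [h]
      rw [hB.limit_add hN hT]
      rfl
    rw [h1, ← map_sub]
    exact hB.seminorm_limit_le hT hp t _

theorem seminormTendsto_limit (x : X) (t : NNReal) :
    SeminormTendsto Γ (fun s => T s x) (𝓝 t) (T t x) := by
  intro p hp
  have h : Tendsto (fun s : NNReal => nndist s t) (𝓝 t) (𝓝 0) := by
    have : Continuous fun s : NNReal => nndist s t := by fun_prop
    simpa using this.tendsto t
  exact squeeze_zero (fun _ => apply_nonneg p _)
    (fun s => hB.seminorm_limit_sub_limit_le hN hT hp x s t)
    ((hB.tendsto_limit_sub hN hT hp x).comp h)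

/-- The vector `A x` need not lie in the domain, so its orbit is compared with that of a domain
vector `v`, which moves by at most `t p (A v)`. -/
theorem seminorm_limit_sub_sub_le {p : Seminorm 𝕜 X} (hp : p ∈ Γ) (t : NNReal)
    (x v : A.domain) :
    p (T t x - x - ((t : ℝ) : 𝕜) • A x) ≤ t * (2 * p (A x - v) + t * p (A v)) := by
  have hL := ((((hT t x).sub (SeminormTendsto.const (x : X))).sub
    ((hB.tendsto x).smul (tendsto_const_nhds (x := ((t : ℝ) : 𝕜))))).tendsto_seminorm hp)
  have hR := (((((hB.tendsto x).sub (SeminormTendsto.const (v : X))).tendsto_seminorm hp).const_mul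
    2).add (((hB.tendsto v).tendsto_seminorm hp).const_mul (t : ℝ))).const_mul (t : ℝ)
  refine le_of_tendsto_of_tendsto hL hR (Eventually.of_forall fun n => ?_)
  refine seminorm_expGroup_sub_sub_le (hN.le_norm hp) (hB.contractive n p hp) t.2 x
    fun s hs hst => ?_
  have h1 : expGroup (B n) s (B n x) - B n x =
      expGroup (B n) s (B n x - v) - (B n x - v) + (expGroup (B n) s v - v) := by
    rw [map_sub]
    abel
  have h2 := seminorm_expGroup_sub_le (hN.le_norm hp) (hB.contractive n p hp) hs (v : X)
  have h3 : s * p (B n v) ≤ t * p (B n v) := mul_le_mul_of_nonneg_right hst (apply_nonneg p _)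
  rw [h1]
  linarith [map_add_le_add p (expGroup (B n) s (B n x - v) - (B n x - v))
      (expGroup (B n) s v - v),
    map_sub_le_add p (expGroup (B n) s (B n x - v)) (B n x - v),
    hB.contractive n p hp s hs (B n x - v)]

theorem seminormTendsto_diffQuotient (x : A.domain) :
    SeminormTendsto Γ (fun t : NNReal => ((t : ℝ) : 𝕜)⁻¹ • (T t x - x)) (𝓝[>] 0) (A x) := by
  intro p hp
  obtain ⟨u, hu, hux⟩ := hB.dense (A x)
  rw [Metric.tendsto_nhds]
  intro ε hε
  obtain ⟨k, hk⟩ := ((hux p hp).eventually_lt_const (show 0 < ε / 4 by positivity)).exists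
  have h1 : Tendsto (fun t : NNReal => (t : ℝ) * p (A ⟨u k, hu k⟩)) (𝓝[>] 0) (𝓝 0) := by
    simpa using ((NNReal.continuous_coe.tendsto 0).mono_left nhdsWithin_le_nhds).mul_const
      (p (A ⟨u k, hu k⟩))
  filter_upwards [h1.eventually_lt_const (show 0 < ε / 4 by positivity), self_mem_nhdsWithin]
    with t ht ht0
  have ht0' : (0 : ℝ) < t := ht0
  rw [Real.dist_eq, sub_zero, abs_of_nonneg (apply_nonneg p _)]
  have h2 : ((t : ℝ) : 𝕜)⁻¹ • (T t x - x) - A x =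
      ((t : ℝ) : 𝕜)⁻¹ • (T t x - x - ((t : ℝ) : 𝕜) • A x) := by
    have : ((t : ℝ) : 𝕜) ≠ 0 := RCLike.ofReal_ne_zero.2 ht0'.ne'
    rw [smul_sub _ (_ - _), inv_smul_smul₀ this]
  have h3 := hB.seminorm_limit_sub_sub_le hN hT hp t x ⟨u k, hu k⟩
  rw [h2, map_smul_eq_mul, norm_inv, RCLike.norm_ofReal, abs_of_pos ht0']
  rw [map_sub_rev p] at hk
  rw [inv_mul_lt_iff₀ ht0']
  refine h3.trans_lt ?_
  gcongr
  change 2 * p (A x - u k) + _ < ε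
  linarith

end Limit

end IsContractiveApproximation

end YosidaLimit

/-! ### Maximality of `A` -/

section Generator

variable {Γ : Set (Seminorm 𝕜 X)} {A : X →ₗ.[𝕜] X} {T : NNReal → X →L[𝕜] X}

/-- A vector which is its own derivative along a contraction semigroup vanishes. -/
theorem eq_zero_of_diffQuotient_tendsto_self (hN : IsNorming Γ)
    (hT : ∀ p ∈ Γ, ∀ t x, p (T t x) ≤ p x) {v : X}
    (hv : SeminormTendsto Γ (fun t : NNReal => ((t : ℝ) : 𝕜)⁻¹ • (T t v - v)) (𝓝[>] 0) v) :
    v = 0 := by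
  refine hN.eq_of_forall_le fun p hp => ?_
  rw [sub_zero]
  refine ge_of_tendsto (hv p hp) ?_
  filter_upwards [self_mem_nhdsWithin] with t ht
  have ht' : (0 : ℝ) < t := ht
  have ht0 : ((t : ℝ) : 𝕜) ≠ 0 := RCLike.ofReal_ne_zero.2 ht'.ne'
  set q := ((t : ℝ) : 𝕜)⁻¹ • (T t v - v) with hq
  -- Contractivity turns this into `(1 + t) p v ≤ p v + t p (q - v)`, so `p v ≤ p (q - v)`, which
  -- tends to 0.
  have h1 : ((1 + t : ℝ) : 𝕜) • v = T t v - ((t : ℝ) : 𝕜) • (q - v) := by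
    rw [smul_sub, hq, smul_inv_smul₀ ht0]
    push_cast
    module
  have h2 := congrArg p h1
  rw [map_smul_eq_mul, RCLike.norm_ofReal, abs_of_pos (by positivity)] at h2
  have h3 := map_sub_le_add p (T t v) (((t : ℝ) : 𝕜) • (q - v))
  rw [← h2, map_smul_eq_mul, RCLike.norm_ofReal, abs_of_pos ht'] at h3
  have h4 := hT p hp t v
  have h5 : (t : ℝ) * p v ≤ t * p (q - v) := by linarith
  exact le_of_mul_le_mul_left h5 ht'

/-- Solve `(1 - A) w = x - y`. Then `x - w` has derivative `y - A w = x - w` at 0, hence vanishes,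
and `x = w` lies in the domain. -/
theorem mem_domain_of_diffQuotient_tendsto (hN : IsNorming Γ)
    (hT : ∀ p ∈ Γ, ∀ t x, p (T t x) ≤ p x) (hs : IsOntoAt A 1)
    (hA : ∀ x : A.domain, SeminormTendsto Γ
      (fun t : NNReal => ((t : ℝ) : 𝕜)⁻¹ • (T t x - x)) (𝓝[>] 0) (A x)) {x y : X}
    (hxy : SeminormTendsto Γ (fun t : NNReal => ((t : ℝ) : 𝕜)⁻¹ • (T t x - x)) (𝓝[>] 0) y) :
    x ∈ A.domain := by
  obtain ⟨w, hw⟩ := hs (x - y)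
  have h := hxy.sub (hA w)
  have h0 : x - w = 0 := by
    refine eq_zero_of_diffQuotient_tendsto_self hN hT ?_
    have h1 : y - A w = x - w := by
      rw [RCLike.ofReal_one, one_smul] at hw
      linear_combination (norm := module) hw
    rw [← h1]
    refine (congrArg (fun f => SeminormTendsto Γ f (𝓝[>] 0) (y - A w)) (funext fun t => ?_)).mp h
    rw [h1, map_sub (T t)]
    module
  rw [sub_eq_zero] at h0
  exact h0 ▸ w.2

end Generator

theorem generatesContractionSemigroup_of_isOntoAt [CompleteSpace X] {τ : AuxTopology X}
    (hτ : IsBiAdmissible 𝕜 τ) {A : X →ₗ.[𝕜] X} (hdiss : BiDissipative τ A)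
    (hdense : BiDenselyDefined τ A) {l : ℝ} (hl : 0 < l) (hs : IsOntoAt A l) :
    GeneratesContractionSemigroup τ A := by
  obtain ⟨Γ, hΓ, hA : IsDissipativeFor Γ A, hN : IsNorming Γ⟩ := hdiss
  have hc := isBoundedlyComplete_of_isFundamentalSystem hτ hΓ
  have hD : ∀ x, ∃ u : ℕ → X, (∀ n, u n ∈ A.domain) ∧ SeminormTendsto Γ u atTop x := by
    intro x
    obtain ⟨u, hu, -, hux⟩ := hdense x
    exact ⟨u, hu, (tendsto_nhds_iff_seminormTendsto hτ.locallyConvex hΓ).1 hux⟩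
  obtain ⟨B, hB⟩ := hA.exists_isContractiveApproximation hN hD hl hs
  obtain ⟨T, hT⟩ := hB.exists_limit hN hc
  have hle : ∀ p ∈ Γ, ∀ t x, p (T t x) ≤ p x := fun p hp => hB.seminorm_limit_le hT hp
  have hnorm : ∀ t, ‖T t‖ ≤ 1 := fun t =>
    (T t).opNorm_le_bound zero_le_one fun x => by
      rw [one_mul]
      exact hN.norm_le fun p hp => (hle p hp t x).trans (hN.le_norm hp x)
  have hderiv : ∀ x : A.domain, HasTauDerivAtZero τ T (x : X) (A x) := fun x =>
    (tendsto_nhds_iff_seminormTendsto hτ.locallyConvex hΓ).2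
      (hB.seminormTendsto_diffQuotient hN hT x)
  refine ⟨T, ⟨hB.limit_add hN hT, limit_expGroup_zero hN hT, fun x => ?_,
    ⟨1, 0, le_rfl, fun t => by simpa using hnorm t⟩, fun u _ hu t₀ U hU => ?_⟩, hnorm,
    ⟨fun x => ⟨fun hx => ⟨⟨_, hderiv ⟨x, hx⟩⟩, ‖A ⟨x, hx⟩‖, fun t ht _ => ?_⟩, ?_⟩, hderiv⟩⟩
  · refine (@continuous_iff_continuousAt _ _ _ τ.top _).2 fun t => ?_
    exact (tendsto_nhds_iff_seminormTendsto hτ.locallyConvex hΓ).2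
      (hB.seminormTendsto_limit hN hT x t)
  · obtain ⟨p, hp, ε, hε, hsub⟩ := hΓ.exists_ball_subset U hU
    have h := (tendsto_nhds_iff_seminormTendsto hτ.locallyConvex hΓ).1 hu p hp
    simp only [sub_zero] at h
    filter_upwards [h.eventually_lt_const hε] with n hn s _
    exact hsub ((hle p hp s (u n)).trans_lt hn)
  · rw [div_le_iff₀' (by exact_mod_cast ht)]
    refine hN.norm_le fun p hp => (hB.seminorm_limit_sub_le hN hT hp t ⟨x, hx⟩).trans ?_
    gcongr
    exact hN.le_norm hp _
  · rintro ⟨⟨y, hy⟩, -⟩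
    exact mem_domain_of_diffQuotient_tendsto hN hle (hA.isOntoAt hN hl hs one_pos)
      (hB.seminormTendsto_diffQuotient hN hT)
      ((tendsto_nhds_iff_seminormTendsto hτ.locallyConvex hΓ).1 hy)

/-! ### Riemann integrals for the seminorms -/

section Integral

variable (𝕜) in
/-- The left Riemann sum of `f` over `[a, a + h]` for the partition into `N + 1` equal pieces. -/
noncomputable def riemannSum (f : ℝ → X) (a h : ℝ) (N : ℕ) : X :=
  ((h / (N + 1 : ℕ) : ℝ) : 𝕜) • ∑ k ∈ Finset.range (N + 1), f (a + k * (h / (N + 1 : ℕ)))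

/-- A left Riemann sum is close to the integral if the integrand oscillates little. -/
theorem norm_riemannSum_sub_integral_le {g : ℝ → 𝕜} (hg : Continuous g) {a h : ℝ} (hh : 0 ≤ h)
    (N : ℕ) {ε : ℝ} (hε : ∀ s ∈ Set.Icc a (a + h), ∀ t ∈ Set.Icc a (a + h),
      |s - t| ≤ h / (N + 1 : ℕ) → ‖g s - g t‖ ≤ ε) :
    ‖riemannSum 𝕜 g a h N - ∫ x in a..a + h, g x‖ ≤ h * ε := by
  set δ := h / (N + 1 : ℕ) with hδ
  have hδ0 : 0 ≤ δ := by positivity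
  have hNδ : ((N + 1 : ℕ) : ℝ) * δ = h := by
    rw [hδ]
    field_simp
  let c : ℕ → ℝ := fun k => a + k * δ
  have hc : ∀ k, c (k + 1) = c k + δ := fun k => by
    simp only [c]
    push_cast
    ring
  have hsum := intervalIntegral.sum_integral_adjacent_intervals (f := g) (a := c) (n := N + 1)
    (μ := MeasureTheory.volume) fun k _ => hg.intervalIntegrable _ _
  have hc0 : c 0 = a := by simp [c]
  have hcN : c (N + 1) = a + h := by
    change a + ((N + 1 : ℕ) : ℝ) * δ = a + h
    rw [hNδ]
  rw [hc0, hcN] at hsum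
  rw [← hsum, riemannSum, Finset.smul_sum, ← Finset.sum_sub_distrib]
  calc ‖∑ k ∈ Finset.range (N + 1), ((δ : 𝕜) • g (c k) - ∫ x in c k..c (k + 1), g x)‖
      ≤ ∑ k ∈ Finset.range (N + 1), ε * δ := by
        refine norm_sum_le_of_le _ fun k hk => ?_
        have h1 : (δ : 𝕜) • g (c k) - ∫ x in c k..c (k + 1), g x =
            ∫ x in c k..c (k + 1), (g (c k) - g x) := by
          rw [intervalIntegral.integral_sub intervalIntegrable_const (hg.intervalIntegrable _ _),
            intervalIntegral.integral_const, hc, add_sub_cancel_left, RCLike.real_smul_eq_coe_mul,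
            smul_eq_mul]
        have hkN : (k : ℝ) + 1 ≤ (N + 1 : ℕ) := by
          exact_mod_cast Nat.succ_le_of_lt (Finset.mem_range.1 hk)
        have hk1 : ((k : ℝ) + 1) * δ ≤ h := by
          rw [← hNδ]
          gcongr
        have hk0 : 0 ≤ k * δ := by positivity
        have hle : c k ≤ c (k + 1) := by rw [hc]; linarith
        rw [h1]
        refine (intervalIntegral.norm_integral_le_of_norm_le_const (C := ε) fun x hx => ?_).trans
          (le_of_eq ?_)
        · rw [Set.uIoc_of_le hle, hc] at hx
          obtain ⟨hx1, hx2⟩ := hx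
          simp only [c] at hx1 hx2
          refine hε _ ⟨?_, ?_⟩ _ ⟨?_, ?_⟩ ?_
          · simp only [c]; linarith
          · simp only [c]; linarith
          · linarith
          · linarith
          · simp only [c]
            rw [abs_le]
            constructor <;> linarith
        · rw [hc, add_sub_cancel_left, abs_of_nonneg hδ0]
    _ = h * ε := by
        rw [Finset.sum_const, Finset.card_range, nsmul_eq_mul, ← hNδ]
        ring

variable {Γ : Set (Seminorm 𝕜 X)} {f : ℝ → X}

/-- The function `(s, t) ↦ p (f s - f t)` is continuous and vanishes on the diagonal; uniform
continuity on the compact square is applied to `(s, t)` and `(t, t)`. -/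
theorem exists_uniform_modulus (p : Seminorm 𝕜 X)
    (hf : ∀ t, Tendsto (fun s => p (f s - f t)) (𝓝 t) (𝓝 0)) (a b : ℝ) {ε : ℝ} (hε : 0 < ε) :
    ∃ δ > 0, ∀ s ∈ Set.Icc a b, ∀ t ∈ Set.Icc a b, |s - t| < δ → p (f s - f t) < ε := by
  have hcont : Continuous fun z : ℝ × ℝ => p (f z.1 - f z.2) := by
    rw [continuous_iff_continuousAt]
    rintro ⟨s, t⟩
    change Tendsto _ _ _
    rw [tendsto_iff_norm_sub_tendsto_zero]
    have h1 := ((hf s).comp (continuous_fst.tendsto (s, t))).add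
      ((hf t).comp (continuous_snd.tendsto (s, t)))
    rw [add_zero] at h1
    refine squeeze_zero (fun _ => norm_nonneg _) (fun z => ?_) h1
    refine (abs_sub_map_le_sub p _ _).trans ?_
    rw [sub_sub_sub_comm]
    exact map_sub_le_add p _ _
  have hu := (isCompact_Icc.prod isCompact_Icc).uniformContinuousOn_of_continuous
    (hcont.continuousOn (s := Set.Icc a b ×ˢ Set.Icc a b))
  obtain ⟨δ, hδ, h⟩ := Metric.uniformContinuousOn_iff.1 hu ε hε
  refine ⟨δ, hδ, fun s hs t ht hst => ?_⟩
  have := h (s, t) ⟨hs, ht⟩ (t, t) ⟨ht, ht⟩ (by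
    rw [Prod.dist_eq, dist_self, max_eq_left dist_nonneg]
    exact hst)
  simpa [Real.dist_eq, abs_of_nonneg (apply_nonneg p _)] using this

theorem continuous_functional_comp {p : Seminorm 𝕜 X} {φ : X →ₗ[𝕜] 𝕜} (hφ : ∀ y, ‖φ y‖ ≤ p y)
    (hf : ∀ t, Tendsto (fun s => p (f s - f t)) (𝓝 t) (𝓝 0)) : Continuous fun t => φ (f t) := by
  rw [continuous_iff_continuousAt]
  intro t
  change Tendsto _ _ _
  rw [tendsto_iff_norm_sub_tendsto_zero]
  refine squeeze_zero (fun _ => norm_nonneg _) (fun s => ?_) (hf t)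
  rw [← map_sub]
  exact hφ _

theorem map_riemannSum (φ : X →ₗ[𝕜] 𝕜) (f : ℝ → X) (a h : ℝ) (N : ℕ) :
    φ (riemannSum 𝕜 f a h N) = riemannSum 𝕜 (fun t => φ (f t)) a h N := by
  simp only [riemannSum, map_smul, map_sum]

/-- Riemann sums converge to the integral uniformly over the functionals dominated by `p`. -/
theorem eventually_norm_map_riemannSum_sub_le {p : Seminorm 𝕜 X}
    (hf : ∀ t, Tendsto (fun s => p (f s - f t)) (𝓝 t) (𝓝 0)) (a : ℝ) {h : ℝ} (hh : 0 ≤ h)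
    {ε : ℝ} (hε : 0 < ε) :
    ∀ᶠ N in atTop, ∀ φ : X →ₗ[𝕜] 𝕜, (∀ y, ‖φ y‖ ≤ p y) →
      ‖φ (riemannSum 𝕜 f a h N) - ∫ x in a..a + h, φ (f x)‖ ≤ ε := by
  -- Dividing by `h + 1` instead of `h` covers `h = 0`.
  have hε' : 0 < ε / (h + 1) := by positivity
  obtain ⟨δ, hδ, hmod⟩ := exists_uniform_modulus p hf a (a + h) hε'
  have hlim : Tendsto (fun N : ℕ => h / (N + 1 : ℕ)) atTop (𝓝 0) :=
    (tendsto_const_div_atTop_nhds_zero_nat h).comp (tendsto_add_atTop_nat 1)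
  filter_upwards [hlim.eventually_lt_const hδ] with N hN φ hφ
  rw [map_riemannSum]
  refine (norm_riemannSum_sub_integral_le (continuous_functional_comp hφ hf) hh N
    (ε := ε / (h + 1)) fun s hs t ht hst => ?_).trans ?_
  · rw [← map_sub]
    exact (hφ _).trans (hmod s hs t ht (hst.trans_lt hN)).le
  · rw [mul_div_assoc', div_le_iff₀ (by positivity)]
    nlinarith

theorem norm_riemannSum_le {C : ℝ} (hC : ∀ t, ‖f t‖ ≤ C) (a : ℝ) {h : ℝ} (hh : 0 ≤ h) (N : ℕ) :
    ‖riemannSum 𝕜 f a h N‖ ≤ h * C := by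
  rw [riemannSum, norm_smul, RCLike.norm_ofReal, abs_of_nonneg (by positivity)]
  calc h / (N + 1 : ℕ) * ‖∑ k ∈ Finset.range (N + 1), f (a + k * (h / (N + 1 : ℕ)))‖
      ≤ h / (N + 1 : ℕ) * ∑ k ∈ Finset.range (N + 1), C := by
        gcongr
        exact norm_sum_le_of_le _ fun k _ => hC _
    _ = h * C := by
        rw [Finset.sum_const, Finset.card_range, nsmul_eq_mul]
        field_simp

/-- `J` is the integral of `f` over `[a, a + h]`, as a limit of Riemann sums for all the seminorms
in `Γ`. -/
structure IsRiemannIntegral (Γ : Set (Seminorm 𝕜 X)) (f : ℝ → X) (a h : ℝ) (J : X) : Prop where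
  tendsto : SeminormTendsto Γ (riemannSum 𝕜 f a h) atTop J
  map_eq : ∀ p ∈ Γ, ∀ φ : X →ₗ[𝕜] 𝕜, (∀ y, ‖φ y‖ ≤ p y) → φ J = ∫ x in a..a + h, φ (f x)

theorem exists_isRiemannIntegral (hc : IsBoundedlyComplete Γ)
    (hf : ∀ t, SeminormTendsto Γ f (𝓝 t) (f t)) {C : ℝ} (hC : ∀ t, ‖f t‖ ≤ C) (a : ℝ) {h : ℝ}
    (hh : 0 ≤ h) : ∃ J, IsRiemannIntegral Γ f a h J := by
  obtain ⟨J, hJ⟩ := hc (riemannSum 𝕜 f a h) ⟨h * C, norm_riemannSum_le hC a hh⟩ (by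
    intro p hp
    rw [Metric.tendsto_nhds]
    intro ε hε
    have hev := eventually_norm_map_riemannSum_sub_le (fun t => hf t p hp) a hh
      (show 0 < ε / 3 by positivity)
    rw [← prod_atTop_atTop_eq]
    filter_upwards [hev.prod_mk hev] with mn hmn
    -- The functional attaining `p` depends on the pair of indices, so the scalar estimate has to be
    -- uniform over all `φ` dominated by `p`.
    obtain ⟨φ, hφ, hφp⟩ :=
      exists_functional_eq_seminorm p (riemannSum 𝕜 f a h mn.1 - riemannSum 𝕜 f a h mn.2)
    rw [Real.dist_eq, sub_zero, abs_of_nonneg (apply_nonneg p _)]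
    have h1 := congrArg norm hφ
    rw [RCLike.norm_ofReal, abs_of_nonneg (apply_nonneg p _), map_sub] at h1
    rw [← h1, ← sub_sub_sub_cancel_right _ _ (∫ x in a..a + h, φ (f x))]
    refine (norm_sub_le _ _).trans_lt ?_
    linarith [hmn.1 φ hφp, hmn.2 φ hφp])
  refine ⟨J, hJ, fun p hp φ hφ => ?_⟩
  have h1 : Tendsto (fun N => φ (riemannSum 𝕜 f a h N)) atTop (𝓝 (φ J)) := by
    rw [tendsto_iff_norm_sub_tendsto_zero]
    refine squeeze_zero (fun _ => norm_nonneg _) (fun N => ?_) (hJ p hp)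
    rw [← map_sub]
    exact hφ _
  refine tendsto_nhds_unique h1 (Metric.tendsto_nhds.2 fun ε hε => ?_)
  filter_upwards [eventually_norm_map_riemannSum_sub_le (fun t => hf t p hp) a hh
    (half_pos hε)] with N hN
  rw [dist_eq_norm]
  exact (hN φ hφ).trans_lt (half_lt_self hε)

namespace IsRiemannIntegral

variable {a b h k : ℝ} {I J I' J' : X}

theorem norm_le (hJ : IsRiemannIntegral Γ f a h J) (hN : IsNorming Γ) (hh : 0 ≤ h) {C : ℝ}
    (hC : ∀ t, ‖f t‖ ≤ C) : ‖J‖ ≤ h * C :=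
  hN.norm_le fun _ hp => le_of_tendsto (hJ.tendsto.tendsto_seminorm hp)
    (Eventually.of_forall fun N => (hN.le_norm hp _).trans (norm_riemannSum_le hC a hh N))

theorem seminorm_sub_smul_le (hJ : IsRiemannIntegral Γ f a h J)
    (hf : ∀ t, SeminormTendsto Γ f (𝓝 t) (f t)) (hh : 0 ≤ h) {p : Seminorm 𝕜 X} (hp : p ∈ Γ)
    {ε : ℝ} (hε : ∀ t, a ≤ t → t ≤ a + h → p (f t - f a) ≤ ε) :
    p (J - (h : 𝕜) • f a) ≤ h * ε := by
  obtain ⟨φ, hφ, hφp⟩ := exists_functional_eq_seminorm p (J - (h : 𝕜) • f a)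
  have h1 := congrArg norm hφ
  rw [RCLike.norm_ofReal, abs_of_nonneg (apply_nonneg p _), map_sub, map_smul,
    hJ.map_eq p hp φ hφp] at h1
  have h2 : (∫ x in a..a + h, φ (f x)) - (h : 𝕜) • φ (f a) =
      ∫ x in a..a + h, (φ (f x) - φ (f a)) := by
    rw [intervalIntegral.integral_sub
      ((continuous_functional_comp hφp fun t => hf t p hp).intervalIntegrable _ _)
      intervalIntegrable_const, intervalIntegral.integral_const, add_sub_cancel_left,
      RCLike.real_smul_eq_coe_mul, smul_eq_mul]
  rw [← h1, h2]
  refine (intervalIntegral.norm_integral_le_of_norm_le_const (C := ε) fun x hx => ?_).trans ?_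
  · rw [Set.uIoc_of_le (by linarith)] at hx
    rw [← map_sub]
    exact (hφp _).trans (hε x hx.1.le hx.2)
  · rw [add_sub_cancel_left, abs_of_nonneg hh, mul_comm]

/-- `∫_{a+h}^{a+h+k} f - ∫_a^{a+k} f = ∫_{a+k}^{a+k+h} f - ∫_a^{a+h} f`. -/
theorem sub_eq_sub (hN : IsNorming Γ) (hf : ∀ t, SeminormTendsto Γ f (𝓝 t) (f t))
    (hI : IsRiemannIntegral Γ f (a + h) k I) (hJ : IsRiemannIntegral Γ f a k J)
    (hI' : IsRiemannIntegral Γ f (a + k) h I') (hJ' : IsRiemannIntegral Γ f a h J') :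
    I - J = I' - J' := by
  refine hN.eq_of_forall_le fun p hp => ?_
  obtain ⟨φ, hφ, hφp⟩ := exists_functional_eq_seminorm p (I - J - (I' - J'))
  have hint : ∀ s t, IntervalIntegrable (fun x => φ (f x)) MeasureTheory.volume s t := fun s t =>
    (continuous_functional_comp hφp fun t => hf t p hp).intervalIntegrable _ _
  have h0 : φ (I - J - (I' - J')) = 0 := by
    rw [map_sub, map_sub, map_sub, hI.map_eq p hp φ hφp, hJ.map_eq p hp φ hφp,
      hI'.map_eq p hp φ hφp, hJ'.map_eq p hp φ hφp]
    have e1 := intervalIntegral.integral_add_adjacent_intervals (hint a (a + h))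
      (hint (a + h) (a + h + k))
    have e2 := intervalIntegral.integral_add_adjacent_intervals (hint a (a + k))
      (hint (a + k) (a + k + h))
    rw [add_right_comm a k h] at e2 ⊢
    rw [← e2] at e1
    linear_combination e1
  rw [h0] at hφ
  exact (RCLike.ofReal_eq_zero.1 hφ.symm).le

end IsRiemannIntegral

end Integral

theorem tendsto_inv_smul_of_isRiemannIntegral {Γ : Set (Seminorm 𝕜 X)} {f : ℝ → X} {a : ℝ}
    {J : NNReal → X} (hf : ∀ t, SeminormTendsto Γ f (𝓝 t) (f t))
    (hJ : ∀ h : NNReal, IsRiemannIntegral Γ f a h (J h)) :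
    SeminormTendsto Γ (fun h : NNReal => ((h : ℝ) : 𝕜)⁻¹ • J h) (𝓝[>] 0) (f a) := by
  intro p hp
  rw [Metric.tendsto_nhds]
  intro ε hε
  obtain ⟨δ, hδ, hball⟩ := Metric.eventually_nhds_iff.1
    ((hf a p hp).eventually_lt_const (half_pos hε))
  have hsmall : ∀ᶠ h : NNReal in 𝓝[>] 0, (h : ℝ) < δ :=
    ((NNReal.continuous_coe.tendsto 0).mono_left nhdsWithin_le_nhds).eventually_lt_const hδ
  filter_upwards [hsmall, self_mem_nhdsWithin] with h hh h0
  have h0' : (0 : ℝ) < h := h0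
  rw [Real.dist_eq, sub_zero, abs_of_nonneg (apply_nonneg p _)]
  have h1 := (hJ h).seminorm_sub_smul_le hf h.coe_nonneg hp (ε := ε / 2) fun t ht1 ht2 =>
    (hball (by rw [Real.dist_eq, abs_of_nonneg (by linarith)]; linarith)).le
  have hne : ((h : ℝ) : 𝕜) ≠ 0 := RCLike.ofReal_ne_zero.2 h0'.ne'
  have h2 : ((h : ℝ) : 𝕜)⁻¹ • J h - f a = ((h : ℝ) : 𝕜)⁻¹ • (J h - ((h : ℝ) : 𝕜) • f a) := by
    rw [smul_sub, inv_smul_smul₀ hne]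
  rw [h2, map_smul_eq_mul, norm_inv, RCLike.norm_ofReal, abs_of_pos h0', inv_mul_lt_iff₀ h0']
  refine h1.trans_lt ?_
  gcongr
  exact half_lt_self hε

/-! ### The truncated Laplace transform -/

section Rescaled

/-- The rescaled semigroup `t ↦ e⁻ᵗ T(t)`. -/
noncomputable def rescale (T : NNReal → X →L[𝕜] X) (t : NNReal) : X →L[𝕜] X :=
  ((Real.exp (-t) : ℝ) : 𝕜) • T t

/-- The orbit of `z` under the rescaled semigroup, extended to negative times by `z`. -/
noncomputable def rescaledOrbit (T : NNReal → X →L[𝕜] X) (z : X) (t : ℝ) : X :=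
  rescale T t.toNNReal z

variable {τ : AuxTopology X} {Γ : Set (Seminorm 𝕜 X)} {T : NNReal → X →L[𝕜] X} {A : X →ₗ.[𝕜] X}

theorem norm_rescale_le (hT : ∀ t, ‖T t‖ ≤ 1) (t : NNReal) :
    ‖rescale T t‖ ≤ Real.exp (-t) := by
  rw [rescale, norm_smul, RCLike.norm_ofReal, abs_of_pos (Real.exp_pos _)]
  exact mul_le_of_le_one_right (Real.exp_pos _).le (hT t)

theorem norm_rescaledOrbit_le (hT : ∀ t, ‖T t‖ ≤ 1) (z : X) (t : ℝ) :
    ‖rescaledOrbit T z t‖ ≤ ‖z‖ := by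
  refine ((rescale T t.toNNReal).le_of_opNorm_le (norm_rescale_le hT _) z).trans ?_
  exact mul_le_of_le_one_left (norm_nonneg z) (Real.exp_le_one_iff.2 (by simp))

theorem rescale_add (hT : ∀ t s, T (t + s) = (T t).comp (T s)) (t s : NNReal) (z : X) :
    rescale T (t + s) z = rescale T t (rescale T s z) := by
  simp only [rescale, hT, smul_apply, map_smul, smul_smul, ContinuousLinearMap.comp_apply]
  rw [NNReal.coe_add, neg_add, Real.exp_add, RCLike.ofReal_mul, mul_comm]

theorem rescale_rescaledOrbit (hT : ∀ t s, T (t + s) = (T t).comp (T s)) (t : NNReal) {s : ℝ}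
    (hs : 0 ≤ s) (z : X) : rescale T t (rescaledOrbit T z s) = rescaledOrbit T z (t + s) := by
  have h : ((t : ℝ) + s).toNNReal = t + s.toNNReal := by
    rw [Real.toNNReal_add t.coe_nonneg hs, Real.toNNReal_coe]
  rw [rescaledOrbit, rescaledOrbit, h, rescale_add hT]

theorem rescale_riemannSum (hT : ∀ t s, T (t + s) = (T t).comp (T s)) (t : NNReal) (z : X) (N : ℕ) :
    rescale T t (riemannSum 𝕜 (rescaledOrbit T z) 0 1 N) =
      riemannSum 𝕜 (rescaledOrbit T z) t 1 N := by
  simp only [riemannSum, map_smul, map_sum]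
  congr 1
  refine Finset.sum_congr rfl fun k _ => ?_
  rw [zero_add, rescale_rescaledOrbit hT t (by positivity)]

variable (hτ : IsBiAdmissible 𝕜 τ) (hΓ : IsFundamentalSystem τ Γ)
  (hT : IsBiContinuousSemigroup τ T)
include hτ hΓ hT

theorem seminormTendsto_rescaledOrbit (z : X) (t : ℝ) :
    SeminormTendsto Γ (rescaledOrbit T z) (𝓝 t) (rescaledOrbit T z t) := by
  have h1 : SeminormTendsto Γ (fun s => T s z) (𝓝 t.toNNReal) (T t.toNNReal z) :=
    (tendsto_nhds_iff_seminormTendsto hτ.locallyConvex hΓ).1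
      (@Continuous.tendsto _ _ _ τ.top _ (hT.stronglyContinuous z) _)
  have h2 : Continuous fun s : NNReal => ((Real.exp (-s) : ℝ) : 𝕜) := by fun_prop
  exact fun p hp => (h1.smul (h2.tendsto _) p hp).comp (continuous_real_toNNReal.tendsto t)

theorem seminormTendsto_rescale {u : ℕ → X} {x : X} (hu : NormBounded u)
    (hux : SeminormTendsto Γ u atTop x) (t : NNReal) :
    SeminormTendsto Γ (fun n => rescale T t (u n)) atTop (rescale T t x) := by
  obtain ⟨C, hC⟩ := hu
  have h0 : SeminormTendsto Γ (fun n => u n - x) atTop 0 := by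
    simpa using hux.sub (SeminormTendsto.const x)
  have h1 : Tendsto (fun n => T t (u n - x)) atTop (@nhds X τ.top 0) := by
    refine tendsto_def.2 fun U hU => ?_
    filter_upwards [hT.locallyBiEquicontinuous (fun n => u n - x)
      ⟨C + ‖x‖, fun n => (norm_sub_le _ _).trans (by gcongr; exact hC n)⟩
      ((tendsto_nhds_iff_seminormTendsto hτ.locallyConvex hΓ).2 h0) t U hU] with n hn
    exact hn t le_rfl
  have h2 := ((tendsto_nhds_iff_seminormTendsto hτ.locallyConvex hΓ).1 h1).add
    (SeminormTendsto.const (T t x))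
  simp only [map_sub, sub_add_cancel, zero_add] at h2
  exact h2.smul tendsto_const_nhds

/-- The operator `rescale T t` shifts Riemann sums. These are norm-bounded, so bi-equicontinuity
carries it past their limit, and uniqueness identifies the result with the integral over the shifted
interval. -/
theorem isRiemannIntegral_rescale (hc : ∀ t, ‖T t‖ ≤ 1) (hN : IsNorming Γ) {z J : X}
    (hJ : IsRiemannIntegral Γ (rescaledOrbit T z) 0 1 J) (t : NNReal) :
    IsRiemannIntegral Γ (rescaledOrbit T z) t 1 (rescale T t J) := by
  obtain ⟨I, hI⟩ := exists_isRiemannIntegral (isBoundedlyComplete_of_isFundamentalSystem hτ hΓ)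
    (seminormTendsto_rescaledOrbit hτ hΓ hT z) (norm_rescaledOrbit_le hc z) t zero_le_one
  have h1 := seminormTendsto_rescale hτ hΓ hT
    ⟨_, norm_riemannSum_le (norm_rescaledOrbit_le hc z) 0 zero_le_one⟩ hJ.tendsto t
  simp only [rescale_riemannSum hT.map_add] at h1
  rwa [← hI.tendsto.unique hN h1]

/-- The integral of the rescaled orbit of `z` over `[0, 1]` solves `(1 - A) J = z - e⁻¹ T(1) z`. -/
theorem exists_sub_generator_eq (hc : ∀ t, ‖T t‖ ≤ 1) (hN : IsNorming Γ)
    (hA : IsGenerator τ T A) (z : X) : ∃ J : A.domain, (J : X) - A J = z - rescale T 1 z := by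
  set f := rescaledOrbit T z with hf_def
  have hf : ∀ t, SeminormTendsto Γ f (𝓝 t) (f t) := seminormTendsto_rescaledOrbit hτ hΓ hT z
  have hfb : ∀ t, ‖f t‖ ≤ ‖z‖ := norm_rescaledOrbit_le hc z
  have hbc := isBoundedlyComplete_of_isFundamentalSystem hτ hΓ
  obtain ⟨J, hJ⟩ := exists_isRiemannIntegral hbc hf hfb 0 zero_le_one
  choose I₁ hI₁ using fun h : NNReal => exists_isRiemannIntegral hbc hf hfb 1 h.coe_nonneg
  choose I₀ hI₀ using fun h : NNReal => exists_isRiemannIntegral hbc hf hfb 0 h.coe_nonneg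
  have hdiff : ∀ h : NNReal, rescale T h J - J = I₁ h - I₀ h := by
    intro h
    have h1 := isRiemannIntegral_rescale hτ hΓ hT hc hN hJ h
    refine IsRiemannIntegral.sub_eq_sub (a := 0) (h := h) (k := 1) hN hf ?_ hJ ?_ (hI₀ h)
    · rwa [zero_add]
    · rw [zero_add]
      exact hI₁ h
  -- Undoing the rescaling produces the extra term `(exp h - 1) J`; after division by `h` it tends
  -- to `J`, the source of the identity part of `1 - A`.
  have hT_eq : ∀ h : NNReal, T h J - J = ((Real.exp h : ℝ) : 𝕜) • (I₁ h - I₀ h) +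
      ((Real.exp h - 1 : ℝ) : 𝕜) • J := by
    intro h
    have h1 : ((Real.exp h : ℝ) : 𝕜) • rescale T h J = T h J := by
      rw [rescale, smul_apply, smul_smul, ← RCLike.ofReal_mul, ← Real.exp_add]
      simp
    rw [← hdiff, smul_sub, h1]
    push_cast
    module
  have hlim : SeminormTendsto Γ (fun h : NNReal => ((h : ℝ) : 𝕜)⁻¹ • (T h J - J)) (𝓝[>] 0)
      (f 1 - f 0 + J) := by
    have h1 := (tendsto_inv_smul_of_isRiemannIntegral hf hI₁).sub
      (tendsto_inv_smul_of_isRiemannIntegral hf hI₀)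
    have hexp : Tendsto (fun h : NNReal => ((Real.exp h : ℝ) : 𝕜)) (𝓝[>] 0) (𝓝 1) := by
      have : Continuous fun h : NNReal => ((Real.exp h : ℝ) : 𝕜) := by fun_prop
      simpa using (this.tendsto 0).mono_left nhdsWithin_le_nhds
    have hcoe : Tendsto (fun h : NNReal => (h : ℝ)) (𝓝[>] 0) (𝓝[≠] 0) := by
      refine tendsto_nhdsWithin_iff.2
        ⟨(NNReal.continuous_coe.tendsto 0).mono_left nhdsWithin_le_nhds, ?_⟩
      filter_upwards [self_mem_nhdsWithin] with h hh
      exact (NNReal.coe_pos.2 hh).ne'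
    have hder : Tendsto (fun h : NNReal => (((h : ℝ)⁻¹ * (Real.exp h - 1) : ℝ) : 𝕜)) (𝓝[>] 0)
        (𝓝 1) := by
      have := (Real.hasDerivAt_exp 0).tendsto_slope_zero.comp hcoe
      simp only [Real.exp_zero, zero_add, smul_eq_mul] at this
      have h3 := ((RCLike.continuous_ofReal (K := 𝕜)).tendsto 1).comp this
      rwa [RCLike.ofReal_one] at h3
    have h2 := (h1.smul hexp).add ((SeminormTendsto.const J).smul hder)
    rw [one_smul, one_smul] at h2
    refine (congrArg (fun g => SeminormTendsto Γ g (𝓝[>] 0) (f 1 - f 0 + J))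
      (funext fun h => ?_)).mp h2
    rw [hT_eq]
    push_cast
    module
  have hmem : J ∈ A.domain := by
    -- The constant comes from `‖I₁ h‖, ‖I₀ h‖ ≤ h ‖z‖`, together with `exp h ≤ exp 1` and `|exp h -
    -- 1| ≤ 2 h` for `h ≤ 1`.
    refine (hA.mem_domain_iff J).2 ⟨⟨_, (tendsto_nhds_iff_seminormTendsto
      hτ.locallyConvex hΓ).2 hlim⟩, Real.exp 1 * (2 * ‖z‖) + 2 * ‖J‖, fun h h0 h1 => ?_⟩
    have h0' : (0 : ℝ) < h := h0
    have h1' : (h : ℝ) ≤ 1 := h1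
    have e1 : ‖I₁ h - I₀ h‖ ≤ h * (2 * ‖z‖) := by
      refine (norm_sub_le _ _).trans ?_
      have b₁ := (hI₁ h).norm_le hN h0'.le hfb
      have b₀ := (hI₀ h).norm_le hN h0'.le hfb
      linarith
    have e2 : |Real.exp h - 1| ≤ 2 * h := by
      have := Real.abs_exp_sub_one_le (x := h) (by rwa [abs_of_pos h0'])
      rwa [abs_of_pos h0'] at this
    have e3 : Real.exp h ≤ Real.exp 1 := Real.exp_le_exp.2 h1'
    rw [div_le_iff₀ h0', hT_eq]
    refine (norm_add_le _ _).trans ?_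
    rw [norm_smul, norm_smul, RCLike.norm_ofReal, RCLike.norm_ofReal, abs_of_pos (Real.exp_pos _)]
    calc Real.exp h * ‖I₁ h - I₀ h‖ + |Real.exp h - 1| * ‖J‖
        ≤ Real.exp 1 * (h * (2 * ‖z‖)) + 2 * h * ‖J‖ := by gcongr
      _ = (Real.exp 1 * (2 * ‖z‖) + 2 * ‖J‖) * h := by ring
  have hAJ : A ⟨J, hmem⟩ = f 1 - f 0 + J :=
    ((tendsto_nhds_iff_seminormTendsto hτ.locallyConvex hΓ).1 (hA.hasTauDeriv ⟨J, hmem⟩)).unique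
      hN hlim
  refine ⟨⟨J, hmem⟩, ?_⟩
  have hf0 : f 0 = z := by
    simp [hf_def, rescaledOrbit, rescale, hT.map_zero]
  have hf1 : f 1 = rescale T 1 z := by
    rw [hf_def, rescaledOrbit, Real.toNNReal_one]
  rw [hAJ, hf0, hf1]
  change J - _ = _
  abel

end Rescaled

theorem isOntoAt_one_of_generatesContractionSemigroup [CompleteSpace X] {τ : AuxTopology X}
    (hτ : IsBiAdmissible 𝕜 τ) {Γ : Set (Seminorm 𝕜 X)} (hΓ : IsFundamentalSystem τ Γ)
    (hN : IsNorming Γ) {A : X →ₗ.[𝕜] X} (hA : GeneratesContractionSemigroup τ A) :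
    IsOntoAt A 1 := by
  obtain ⟨T, hT, hc, hgen⟩ := hA
  intro y
  obtain ⟨z, hz⟩ := exists_sub_apply_eq (rescale T 1)
    ((norm_rescale_le hc 1).trans_lt (Real.exp_lt_one_iff.2 (by simp))) y
  obtain ⟨J, hJ⟩ := exists_sub_generator_eq hτ hΓ hT hc hN hgen z
  refine ⟨J, ?_⟩
  rw [RCLike.ofReal_one, one_smul, hJ, hz]

end BiCont

theorem theorem3p5 {𝕜 X : Type*} [RCLike 𝕜] [NormedAddCommGroup X] [NormedSpace 𝕜 X]
    [CompleteSpace X] (τ : BiCont.AuxTopology X) (hτ : BiCont.IsBiAdmissible 𝕜 τ)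
    (A : X →ₗ.[𝕜] X) (hdiss : BiCont.BiDissipative τ A) (hdense : BiCont.BiDenselyDefined τ A)
    (hclosed : A.IsClosed) :
    BiCont.GeneratesContractionSemigroup τ A ↔
      ∃ l : ℝ, 0 < l ∧ ∀ y : X, ∃ x : A.domain, (l : 𝕜) • (x : X) - A x = y := by
  constructor
  · intro h
    obtain ⟨Γ, hΓ, -, hN⟩ := hdiss
    exact ⟨1, one_pos, BiCont.isOntoAt_one_of_generatesContractionSemigroup hτ hΓ hN h⟩
  · rintro ⟨l, hl, hs⟩
    exact BiCont.generatesContractionSemigroup_of_isOntoAt hτ hdiss hdense hl hs
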